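/- Let $G$ be a simple triangulation of the sphere, i.e. a connected finite simple planar map (a graph with a clockwise cyclic ordering of the edges at each vertex, of genus $0$) all of whose faces have degree $3$, and let $\xi$ be a corner of $G$, incident to the vertex $v$ and to the root face. Draw $G$ in the plane with the root face unbounded and let $v,A,B$ be the vertices of the root face in clockwise order. A $3$-orientation is an orientation of the edges for which $A$, $B$ and $v$ have outdegrees $0$, $1$ and $2$ and every other vertex has outdegree $3$. It is minimal if every simple directed cycle has $\xi$ on its left. Let $\overrightarrow{E}$ be the minimal $3$-orientation of $(G,\xi)$. For $e=uw\in\overrightarrow{E}$, there is a unique directed path $P(e)=(u_0,u_1,\dots,u_\ell)$ with $u_0=u$, $u_1=w$, $u_\ell=A$ such that for $1\le i\le \ell-1$, $u_iu_{i+1}$ is the first outgoing edge at $u_i$ when the edges at $u_i$ are considered in clockwise order starting from $\{u_{i-1},u_i\}$; it is called the leftmost path from $e$ to $A$. For a simple path $Q=(v_0,\dots,v_m)$ in $G$ (not necessarily directed) with $v_0=u$ and $v_m=A$, let $C=(v_0,\dots,v_m=u_\ell,u_{\ell-1},\dots,u_0)$ be the closed walk which follows $Q$ and then $P(e)$ backwards,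 and let $w(Q,e)\in\mathbb Z$ be the winding number of $C$ around a point of the face incident to the corner at $u$ lying immediately to the right of $uw$, relative to a reference point in the root face. Here winding numbers are counted positively counterclockwise; as a function on the faces, the winding number of $C$ is the unique integer-valued function which vanishes on the root face and whose value on the left of any oriented edge $xy$ exceeds its value on the right of $xy$ by the number of traversals of $xy$ minus the number of traversals of $yx$ by $C$. Proposition. For every $e=uw\in\overrightarrow{E}$ and every simple path $Q$ from $u$ to $A$, $$|Q|\ \ge\ |P(e)|+2\,\bigl(w(Q,e)-2\bigr),$$ where $|\cdot|$ denotes the number of vertices of a path. -/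

import Mathlib

/-- A planar map on the vertex set `V`: a connected simple graph with at least one edge,
together with a cyclic (clockwise) ordering of the edges around every vertex, of genus `0`.

A dart `d` of the graph is an oriented edge, from `d.fst` to `d.snd`; it represents its edge among
the edges incident to `d.fst`. The permutation `cw` sends a dart to the next dart in clockwise order
around the same origin. Faces are the orbits of the permutation which follows a dart `uv` and then
leaves `v` along the edge that comes next after `vu` in clockwise order around `v`, so that the face
stays on the left; the last field is Euler's formula for these faces. -/
structure PlanarMap (V : Type*) [Fintype V] [DecidableEq V] where
  graph : SimpleGraph V
  connected : graph.Connected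
  cw : Equiv.Perm graph.Dart
  cw_fst : ∀ d, (cw d).fst = d.fst
  cw_sameCycle : ∀ d d' : graph.Dart, d.fst = d'.fst → cw.SameCycle d d'
  euler : (Nat.card V : ℤ) - Nat.card graph.edgeSet
    + Nat.card (Quotient (Equiv.Perm.SameCycle.setoid
        (((SimpleGraph.Dart.symm_involutive (G := graph)).toPerm).trans cw))) = 2

namespace PlanarMap

variable {V : Type*} [Fintype V] [DecidableEq V] (M : PlanarMap V)

/-- The next dart along the face on the left: after `uv` comes the dart leaving `v` which follows
`vu` in clockwise order around `v`. -/
def faceNext : Equiv.Perm M.graph.Dart :=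
  ((SimpleGraph.Dart.symm_involutive (G := M.graph)).toPerm).trans M.cw

/-- The faces of the map. -/
def Face : Type _ := Quotient (Equiv.Perm.SameCycle.setoid M.faceNext)

/-- The face on the left of a dart. -/
def leftFace (d : M.graph.Dart) : M.Face :=
  Quotient.mk (Equiv.Perm.SameCycle.setoid M.faceNext) d

/-- Corners. A corner at `v` is a pair `(e, e')` of edges at `v` with `e'` next after `e` in
clockwise order around `v`; it is recorded by the dart of `e'` which leaves `v`. -/
abbrev Corner := M.graph.Dart

/-- The vertex incident to a corner. -/
def cornerVertex (c : M.Corner) : V := c.fst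

/-- The face incident to a corner `(e, e')` at `v`: the face on the left when following `e` towards
`v` and then `e'` away from `v`. -/
def cornerFace (c : M.Corner) : M.Face := M.leftFace c

/-- The corner at `u` incident to `uw` which is on the right when following `uw` from `u` to `w`:
the corner between `uw` and the next edge in clockwise order around `u`. -/
def rightCorner (e : M.graph.Dart) : M.Corner := M.cw e

/-- The map is a triangulation: every face has degree three (is incident to three corners). -/
def IsTriangulation : Prop :=
  ∀ f : M.Face, Nat.card {c : M.Corner // M.cornerFace c = f} = 3

/-- For a triangulation with root corner `ξ` at `v`, drawn in the plane with the root face as the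
unbounded face, the vertices of the root face in clockwise order are `v`, `A`, `B`. As the root face
is then on the left of `vA` and of `AB`, this is the order in which `faceNext` visits them. -/
def vertexA (ξ : M.Corner) : V := ξ.snd

/-- The third vertex `B` of the root face; see `vertexA`. -/
def vertexB (ξ : M.Corner) : V := (M.faceNext ξ).snd

/-- `O` is an orientation: it contains exactly one of the two darts of each edge. -/
def IsOrientation (O : Set M.graph.Dart) : Prop := ∀ d, d ∈ O ↔ d.symm ∉ O

/-- The outdegree of a vertex with respect to an orientation. -/
noncomputable def outdeg (O : Set M.graph.Dart) (x : V) : ℕ :=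
  Nat.card {d : M.graph.Dart // d ∈ O ∧ d.fst = x}

/-- `O` is a 3-orientation of the triangulation planted at `ξ`: the vertices `A`, `B` and `v` of the
root face have outdegrees `0`, `1` and `2`, and all other vertices have outdegree `3`. -/
structure IsThreeOrientation (ξ : M.Corner) (O : Set M.graph.Dart) : Prop where
  isOrientation : M.IsOrientation O
  outdeg_A : M.outdeg O (M.vertexA ξ) = 0
  outdeg_B : M.outdeg O (M.vertexB ξ) = 1
  outdeg_v : M.outdeg O (M.cornerVertex ξ) = 2
  outdeg_inner : ∀ x, x ≠ M.vertexA ξ → x ≠ M.vertexB ξ → x ≠ M.cornerVertex ξ → M.outdeg O x = 3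

variable {M}

/-- The face `f` lies on the left of the cycle `c`: it can be reached from a face on the left of some
dart of `c` by moving between faces through edges which are not on `c`. -/
def LiesLeft {x : V} (c : M.graph.Walk x x) (f : M.Face) : Prop :=
  ∃ d ∈ c.darts, Relation.ReflTransGen
    (fun g g' => ∃ b : M.graph.Dart,
      b.edge ∉ c.edges ∧ M.leftFace b = g ∧ M.leftFace b.symm = g') (M.leftFace d) f

variable (M)

/-- An orientation is minimal if it has no counterclockwise cycle, that is, if each of its directed
cycles is clockwise: the root corner is situated on its left. -/
def IsMinimal (ξ : M.Corner) (O : Set M.graph.Dart) : Prop :=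
  ∀ (x : V) (c : M.graph.Walk x x), c.IsCycle → (∀ d ∈ c.darts, d ∈ O) →
    LiesLeft c (M.cornerFace ξ)

/-- Having arrived at a vertex along the dart `d`, the dart `d'` is the first outgoing one when
considering the edges at this vertex in clockwise order starting from the edge of `d`. -/
def IsLeftmostTurn (O : Set M.graph.Dart) (d d' : M.graph.Dart) : Prop :=
  ∃ k : ℕ, (M.cw ^ k) d.symm = d' ∧ d' ∈ O ∧ ∀ j < k, (M.cw ^ j) d.symm ∉ O

variable {M}

/-- `P` is a leftmost (directed) path starting with the oriented edge `e`. -/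
structure IsLeftmostPath (O : Set M.graph.Dart) (e : M.graph.Dart) {a : V}
    (P : M.graph.Walk e.fst a) : Prop where
  starts : P.darts.head? = some e
  directed : ∀ d ∈ P.darts, d ∈ O
  leftmost : P.darts.IsChain (M.IsLeftmostTurn O)

/-- `h` gives the winding numbers of the closed walk `C` around the points of the faces, relative to
a reference point in the face `r`: it vanishes on `r`, and across every edge its value on the left
exceeds its value on the right by the net number of times that `C` runs along the edge. (So the value
is `1` inside a simple cycle run counterclockwise, when `r` is outside.) -/
def IsWinding (r : M.Face) {x : V} (C : M.graph.Walk x x) (h : M.Face → ℤ) : Prop :=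
  h r = 0 ∧ ∀ d : M.graph.Dart,
    h (M.leftFace d) - h (M.leftFace d.symm) = (C.darts.count d : ℤ) - C.darts.count d.symm

end PlanarMap

namespace PlanarMap

variable {V : Type*} [Fintype V] [DecidableEq V] (M : PlanarMap V)

/-! The argument is a discrete Gauss–Bonnet theorem. Weigh every outgoing dart by 1 and add one unit
on each of the three root edges (`outWeight`), so that every vertex except `A` carries total weight
3. Charge -1 to each side of an edge, or 0 to a side in the root face (`sideWeight`). There is then
an "angle" on corners that grows by the weight of a dart when turning clockwise past it, and by the
side cost when following a side. The defects 3 at the vertices and in the faces are absorbed by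
three times a unit flow to `A` and three times the disk swept by that flow (`Reference`,
`IsPotential`). The angle exists because of Euler's formula, used as a Hodge decomposition
(`exists_add_of_mem_antisymm`). Integrating it along the left side of a simple path
(`potential_sub_eq`) relates the path's length, its winding, and the weight `turnSum` leaving it to
the left.

For a directed cycle with the root face on its left, the flow from a vertex of the cycle crosses to
the left exactly once. If all turns but one were leftmost, the remaining turn would thus have weight
at least 3 on its left, besides the outgoing edge of the cycle, against a total of 3
(`not_isChain_isLeftmostTurn_of_isCycle`). Hence leftmost walks are simple and reach `A`.

For `P = P(e)` the left weight vanishes. Comparing the identities of `P` and `Q` gives `|P| + 3w + T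
≤ |Q| + 3`, where `w` is the winding number and `T ≥ 0` the left weight of `Q`
(`length_add_turnSum_le`). If `w ≥ 0`, drop `T`. If `w < 0`, use `-w ≤ T` (`neg_right_le_turnSum`):
for the winding to the right of `P` to climb from `w` to a nonnegative value at `A`, `Q` must
repeatedly leave an outgoing edge of `P` on its left. -/

instance finite_dart : Finite M.graph.Dart :=
  Finite.of_injective _ SimpleGraph.Dart.toProd_injective

noncomputable instance fintypeDart : Fintype M.graph.Dart := Fintype.ofFinite _

instance finite_face : Finite M.Face := Quotient.finite _

noncomputable instance fintypeFace : Fintype M.Face := Fintype.ofFinite _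

noncomputable instance decidableEqFace : DecidableEq M.Face := Classical.decEq _

variable {M}

/-! ### Darts, faces and connectivity of the dual -/

theorem faceNext_apply (d : M.graph.Dart) : M.faceNext d = M.cw d.symm := rfl

@[simp]
theorem cw_pow_fst (n : ℕ) (d : M.graph.Dart) : ((M.cw ^ n) d).fst = d.fst := by
  induction n with
  | zero => rfl
  | succ n ih => rw [pow_succ', Equiv.Perm.mul_apply, M.cw_fst, ih]

@[simp]
theorem faceNext_fst (d : M.graph.Dart) : (M.faceNext d).fst = d.snd := by
  rw [faceNext_apply, M.cw_fst]; rfl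

@[simp]
theorem leftFace_faceNext (d : M.graph.Dart) : M.leftFace (M.faceNext d) = M.leftFace d :=
  Quotient.sound (Equiv.Perm.sameCycle_apply_left.2 (Equiv.Perm.SameCycle.refl _ _))

theorem leftFace_cw (b : M.graph.Dart) : M.leftFace (M.cw b) = M.leftFace b.symm := by
  rw [← leftFace_faceNext b.symm, faceNext_apply, b.symm_symm]

theorem exists_pow_cw_eq {a b : M.graph.Dart} (h : a.fst = b.fst) : ∃ n : ℕ, (M.cw ^ n) a = b :=
  (M.cw_sameCycle a b h).exists_nat_pow_eq

/-- Rotation is transitive at each vertex and the graph is connected, so rotations and reversals act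
transitively on darts. Read on left faces, this is connectivity of the dual graph. -/
theorem forall_dart_of_cw_of_symm (p : M.graph.Dart → Prop) (hcw : ∀ d, p d → p (M.cw d))
    (hsymm : ∀ d, p d → p d.symm) {d₀ : M.graph.Dart} (h₀ : p d₀) (d : M.graph.Dart) : p d := by
  have hpow : ∀ (n : ℕ) (d), p d → p ((M.cw ^ n) d) := by
    intro n
    induction n with
    | zero => intro d h; exact h
    | succ n ih => intro d h; rw [pow_succ', Equiv.Perm.mul_apply]; exact hcw _ (ih d h)
  have hvert : ∀ {a b : M.graph.Dart}, a.fst = b.fst → p a → p b := by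
    intro a b hab ha
    obtain ⟨n, rfl⟩ := exists_pow_cw_eq hab
    exact hpow n a ha
  have hwalk : ∀ {x y : V} (w : M.graph.Walk x y), (∀ b : M.graph.Dart, b.fst = x → p b) →
      ∀ b : M.graph.Dart, b.fst = y → p b := by
    intro x y w
    induction w with
    | nil => exact id
    | @cons u v w h q ih =>
      intro hx
      apply ih
      intro b hb
      refine hvert ?_ (hsymm ⟨(u, v), h⟩ (hx _ rfl))
      exact hb.symm
  obtain ⟨w⟩ := M.connected.preconnected d₀.fst d.fst
  exact hwalk w (fun b hb => hvert hb.symm h₀) d rfl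

theorem leftFace_surjective (f : M.Face) : ∃ d, M.leftFace d = f := Quotient.exists_rep f

theorem forall_face_of_adj (p : M.Face → Prop)
    (h : ∀ d : M.graph.Dart, p (M.leftFace d) → p (M.leftFace d.symm)) {f₀ : M.Face} (h₀ : p f₀)
    (f : M.Face) : p f := by
  obtain ⟨d₀, rfl⟩ := leftFace_surjective f₀
  obtain ⟨d, rfl⟩ := leftFace_surjective f
  refine forall_dart_of_cw_of_symm (fun d => p (M.leftFace d)) ?_ h h₀ d
  intro d hd
  rw [leftFace_cw]
  exact h d hd

/-! ### Hodge decomposition from Euler's formula -/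

variable (M)

/-- The coboundary of a function on the vertices. -/
def vertexDiff : (V → ℚ) →ₗ[ℚ] (M.graph.Dart → ℚ) where
  toFun φ d := φ d.snd - φ d.fst
  map_add' φ ψ := by ext d; simp only [Pi.add_apply]; ring
  map_smul' c φ := by ext d; simp only [Pi.smul_apply, smul_eq_mul, RingHom.id_apply]; ring

/-- The jumps of a function on the faces when crossing a dart from its right to its left. -/
def faceDiff : (M.Face → ℚ) →ₗ[ℚ] (M.graph.Dart → ℚ) where
  toFun h d := h (M.leftFace d) - h (M.leftFace d.symm)
  map_add' φ ψ := by ext d; simp only [Pi.add_apply]; ring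
  map_smul' c φ := by ext d; simp only [Pi.smul_apply, smul_eq_mul, RingHom.id_apply]; ring

/-- The antisymmetric functions on the darts. -/
def antisymm : Submodule ℚ (M.graph.Dart → ℚ) where
  carrier := {a | ∀ d, a d.symm = -a d}
  add_mem' ha hb d := by simp only [Pi.add_apply, ha d, hb d]; ring
  zero_mem' d := by simp
  smul_mem' c a ha d := by simp only [Pi.smul_apply, smul_eq_mul, ha d]; ring

variable {M}

theorem vertexDiff_apply (φ : V → ℚ) (d : M.graph.Dart) :
    M.vertexDiff φ d = φ d.snd - φ d.fst := rfl

theorem faceDiff_apply (h : M.Face → ℚ) (d : M.graph.Dart) :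
    M.faceDiff h d = h (M.leftFace d) - h (M.leftFace d.symm) := rfl

theorem vertexDiff_mem_antisymm (φ : V → ℚ) : M.vertexDiff φ ∈ M.antisymm := by
  intro d
  have h1 : d.symm.snd = d.fst := rfl
  have h2 : d.symm.fst = d.snd := rfl
  rw [vertexDiff_apply, vertexDiff_apply, h1, h2]; ring

theorem faceDiff_mem_antisymm (h : M.Face → ℚ) : M.faceDiff h ∈ M.antisymm := by
  intro d
  rw [faceDiff_apply, faceDiff_apply, d.symm_symm]; ring

theorem sum_symm (F : M.graph.Dart → ℚ) : ∑ d : M.graph.Dart, F d.symm = ∑ d, F d :=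
  Equiv.sum_comp (SimpleGraph.Dart.symm_involutive (G := M.graph)).toPerm F

theorem sum_mul_vertexDiff {a : M.graph.Dart → ℚ} (ha : a ∈ M.antisymm) (φ : V → ℚ) :
    ∑ d, a d * M.vertexDiff φ d = -2 * ∑ x, φ x * ∑ d : M.graph.Dart with d.fst = x, a d := by
  have h1 : ∑ d : M.graph.Dart, a d * φ d.snd = - ∑ d : M.graph.Dart, a d * φ d.fst := by
    rw [← sum_symm, ← Finset.sum_neg_distrib]
    refine Finset.sum_congr rfl fun d _ => ?_
    rw [ha d]
    change -a d * φ d.fst = _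
    ring
  have h2 : ∑ x, φ x * ∑ d : M.graph.Dart with d.fst = x, a d =
      ∑ d : M.graph.Dart, a d * φ d.fst := by
    rw [← Finset.sum_fiberwise Finset.univ (fun d : M.graph.Dart => d.fst)]
    refine Finset.sum_congr rfl fun x _ => ?_
    rw [Finset.mul_sum]
    refine Finset.sum_congr rfl fun d hd => ?_
    rw [(Finset.mem_filter.1 hd).2]; ring
  simp only [vertexDiff_apply, mul_sub, Finset.sum_sub_distrib, h1, h2]
  ring

theorem sum_mul_faceDiff {a : M.graph.Dart → ℚ} (ha : a ∈ M.antisymm) (h : M.Face → ℚ) :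
    ∑ d, a d * M.faceDiff h d = 2 * ∑ d : M.graph.Dart, a d * h (M.leftFace d) := by
  have h1 : ∑ d : M.graph.Dart, a d * h (M.leftFace d.symm) =
      - ∑ d : M.graph.Dart, a d * h (M.leftFace d) := by
    rw [← sum_symm, ← Finset.sum_neg_distrib]
    refine Finset.sum_congr rfl fun d _ => ?_
    rw [ha d, d.symm_symm]; ring
  simp only [faceDiff_apply, mul_sub, Finset.sum_sub_distrib, h1]
  ring

theorem sum_mul_leftFace (a : M.graph.Dart → ℚ) (h : M.Face → ℚ) :
    ∑ d : M.graph.Dart, a d * h (M.leftFace d) =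
      ∑ f, h f * ∑ d : M.graph.Dart with M.leftFace d = f, a d := by
  rw [← Finset.sum_fiberwise Finset.univ (fun d : M.graph.Dart => M.leftFace d)]
  refine Finset.sum_congr rfl fun x _ => ?_
  rw [Finset.mul_sum]
  refine Finset.sum_congr rfl fun d hd => ?_
  rw [(Finset.mem_filter.1 hd).2]; ring

theorem sum_comp_faceNext (F : M.graph.Dart → ℚ) : ∑ d, F (M.faceNext d) = ∑ d, F d :=
  Equiv.sum_comp M.faceNext F

/-- Gradients have no circulation around a face: the increments of `φ` telescope along each
`faceNext` orbit. -/
theorem sum_vertexDiff_mul_faceDiff (φ : V → ℚ) (h : M.Face → ℚ) :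
    ∑ d, M.vertexDiff φ d * M.faceDiff h d = 0 := by
  rw [sum_mul_faceDiff (vertexDiff_mem_antisymm φ)]
  have : ∑ d : M.graph.Dart, φ d.snd * h (M.leftFace d) =
      ∑ d : M.graph.Dart, φ d.fst * h (M.leftFace d) := by
    rw [← sum_comp_faceNext (fun d => φ d.fst * h (M.leftFace d))]
    simp
  simp only [vertexDiff_apply, sub_mul, Finset.sum_sub_distrib, this]
  ring

theorem eq_zero_of_sum_mul_self {a : M.graph.Dart → ℚ} (h : ∑ d, a d * a d = 0) : a = 0 := by
  funext d
  have := (Finset.sum_eq_zero_iff_of_nonneg (fun d _ => mul_self_nonneg (a d))).1 h d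
    (Finset.mem_univ d)
  exact mul_self_eq_zero.1 this

theorem finrank_ker_faceDiff_le : Module.finrank ℚ (LinearMap.ker M.faceDiff) ≤ 1 := by
  have : LinearMap.ker M.faceDiff ≤ Submodule.span ℚ {fun _ => (1 : ℚ)} := by
    intro h hh
    rw [LinearMap.mem_ker] at hh
    have hconst : ∃ c : ℚ, ∀ f, h f = c := by
      rcases isEmpty_or_nonempty M.Face with he | ⟨⟨f₀⟩⟩
      · exact ⟨0, fun f => he.elim f⟩
      · refine ⟨h f₀, forall_face_of_adj (fun f => h f = h f₀) (fun d hd => ?_) rfl⟩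
        have := congrFun hh d
        rw [faceDiff_apply, Pi.zero_apply, sub_eq_zero] at this
        exact this ▸ hd
    obtain ⟨c, hc⟩ := hconst
    rw [Submodule.mem_span_singleton]
    exact ⟨c, by ext f; simp [hc f]⟩
  exact (Submodule.finrank_mono this).trans ((finrank_span_le_card _).trans (by simp))

theorem finrank_ker_vertexDiff_le : Module.finrank ℚ (LinearMap.ker M.vertexDiff) ≤ 1 := by
  have : LinearMap.ker M.vertexDiff ≤ Submodule.span ℚ {fun _ => (1 : ℚ)} := by
    intro φ hφ
    rw [LinearMap.mem_ker] at hφ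
    have hwalk : ∀ {x y : V} (_ : M.graph.Walk x y), φ x = φ y := by
      intro x y w
      induction w with
      | nil => rfl
      | @cons u v w h q ih =>
        have := congrFun hφ ⟨(u, v), h⟩
        rw [vertexDiff_apply, Pi.zero_apply, sub_eq_zero] at this
        exact this.symm.trans ih
    obtain ⟨x₀⟩ := M.connected.nonempty
    rw [Submodule.mem_span_singleton]
    refine ⟨φ x₀, ?_⟩
    ext x
    obtain ⟨w⟩ := M.connected.preconnected x₀ x
    simp [hwalk w]
  exact (Submodule.finrank_mono this).trans ((finrank_span_le_card _).trans (by simp))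

theorem finrank_antisymm_le : Module.finrank ℚ M.antisymm ≤ Nat.card M.graph.edgeSet := by
  classical
  have : Fintype M.graph.edgeSet := Fintype.ofFinite _
  have hex : ∀ e : M.graph.edgeSet, ∃ d : M.graph.Dart, d.edge = e := by
    rintro ⟨e, he⟩
    induction e using Sym2.ind with
    | _ x y => exact ⟨⟨(x, y), he⟩, rfl⟩
  choose r hr using hex
  let L : M.antisymm →ₗ[ℚ] (M.graph.edgeSet → ℚ) :=
    (LinearMap.funLeft ℚ ℚ r).comp M.antisymm.subtype
  have hL : Function.Injective L := by
    rw [← LinearMap.ker_eq_bot, LinearMap.ker_eq_bot']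
    rintro ⟨a, ha⟩ h0
    have h0' : ∀ e, a (r e) = 0 := fun e => congrFun h0 e
    ext d
    have hd := hr ⟨d.edge, d.edge_mem⟩
    rcases (SimpleGraph.dart_edge_eq_iff _ _).1 hd with h | h
    · have := h0' ⟨d.edge, d.edge_mem⟩
      rw [h] at this
      exact this
    · have := h0' ⟨d.edge, d.edge_mem⟩
      rw [h, ha d, neg_eq_zero] at this
      exact this
  have := LinearMap.finrank_le_finrank_of_injective hL
  rwa [Module.finrank_fintype_fun_eq_card, ← Nat.card_eq_fintype_card] at this

/-- The decomposition of antisymmetric functions given by Euler's formula. -/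
theorem exists_add_of_mem_antisymm {a : M.graph.Dart → ℚ} (ha : a ∈ M.antisymm) :
    ∃ φ h, a = M.vertexDiff φ + M.faceDiff h := by
  have hdisj : LinearMap.range M.vertexDiff ⊓ LinearMap.range M.faceDiff = ⊥ := by
    rw [eq_bot_iff]
    rintro _ ⟨⟨φ, rfl⟩, ⟨h, hh⟩⟩
    rw [Submodule.mem_bot]
    apply eq_zero_of_sum_mul_self
    conv_lhs => enter [2, d]; rw [← congrFun hh d]
    rw [← sum_vertexDiff_mul_faceDiff φ h]
    exact Finset.sum_congr rfl fun d _ => by rw [congrFun hh d]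
  have hle : LinearMap.range M.vertexDiff ⊔ LinearMap.range M.faceDiff ≤ M.antisymm := by
    rw [sup_le_iff]
    constructor
    · rintro _ ⟨φ, rfl⟩; exact vertexDiff_mem_antisymm φ
    · rintro _ ⟨φ, rfl⟩; exact faceDiff_mem_antisymm φ
  have h1 := Submodule.finrank_sup_add_finrank_inf_eq (LinearMap.range M.vertexDiff)
    (LinearMap.range M.faceDiff)
  rw [hdisj, finrank_bot] at h1
  have h2 := LinearMap.finrank_range_add_finrank_ker M.vertexDiff
  have h3 := LinearMap.finrank_range_add_finrank_ker M.faceDiff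
  rw [Module.finrank_fintype_fun_eq_card, ← Nat.card_eq_fintype_card] at h2 h3
  have h4 := finrank_ker_vertexDiff_le (M := M)
  have h5 := finrank_ker_faceDiff_le (M := M)
  have h6 := finrank_antisymm_le (M := M)
  have h7 : (Nat.card V : ℤ) - Nat.card M.graph.edgeSet + Nat.card M.Face = 2 := M.euler
  -- The orthogonal ranges have dimensions at least `|V| - 1` and `|F| - 1`; by Euler's formula
  -- these add up to `|E|`, which bounds the dimension of the antisymmetric functions.
  have heq := Submodule.eq_of_le_of_finrank_le hle (by omega)
  rw [← heq, Submodule.mem_sup] at ha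
  obtain ⟨_, ⟨φ, rfl⟩, _, ⟨h, rfl⟩, rfl⟩ := ha
  exact ⟨φ, h, rfl⟩

/-- A divergence-free function is orthogonal to all gradients, hence to its own gradient part, which
must vanish. The dual argument treats functions without circulation. -/
theorem exists_faceDiff_eq {a : M.graph.Dart → ℚ} (ha : a ∈ M.antisymm)
    (hdiv : ∀ x, ∑ d : M.graph.Dart with d.fst = x, a d = 0) : ∃ h, M.faceDiff h = a := by
  obtain ⟨φ, h, rfl⟩ := exists_add_of_mem_antisymm ha
  have h1 := (sum_mul_vertexDiff ha φ).trans
    (by rw [Finset.sum_eq_zero (fun x _ => by rw [hdiv x, mul_zero]), mul_zero])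
  simp only [Pi.add_apply, add_mul, Finset.sum_add_distrib] at h1
  have h2 := sum_vertexDiff_mul_faceDiff φ h
  simp only [mul_comm (M.faceDiff h _)] at h1
  rw [h2, add_zero] at h1
  exact ⟨h, by rw [eq_zero_of_sum_mul_self h1, zero_add]⟩

theorem exists_vertexDiff_eq {a : M.graph.Dart → ℚ} (ha : a ∈ M.antisymm)
    (hcurl : ∀ f, ∑ d : M.graph.Dart with M.leftFace d = f, a d = 0) :
    ∃ φ, M.vertexDiff φ = a := by
  obtain ⟨φ, h, rfl⟩ := exists_add_of_mem_antisymm ha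
  have h1 := (sum_mul_faceDiff ha h).trans (by
    rw [sum_mul_leftFace, Finset.sum_eq_zero (fun f _ => by rw [hcurl f, mul_zero]), mul_zero])
  simp only [Pi.add_apply, add_mul, Finset.sum_add_distrib] at h1
  rw [sum_vertexDiff_mul_faceDiff φ h, zero_add] at h1
  exact ⟨φ, by rw [eq_zero_of_sum_mul_self h1, add_zero]⟩

theorem eq_of_faceDiff_eq {h h' : M.Face → ℚ} (hd : M.faceDiff h = M.faceDiff h') {r : M.Face}
    (hr : h r = h' r) : h = h' := by
  funext f
  refine forall_face_of_adj (fun f => h f = h' f) (fun d hf => ?_) hr f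
  have := congrFun hd d
  rw [faceDiff_apply, faceDiff_apply] at this
  linarith

/-! ### Sums over the darts in a sector at a vertex -/

/-- The number of clockwise steps, at least one, which lead from the dart `a` to the dart `b` around
their common origin. -/
noncomputable def turn (a b : M.graph.Dart) : ℕ := sInf {j | 1 ≤ j ∧ (M.cw ^ j) a = b}

theorem turn_spec {a b : M.graph.Dart} (h : a.fst = b.fst) :
    1 ≤ turn a b ∧ (M.cw ^ turn a b) a = b := by
  have hne : {j | 1 ≤ j ∧ (M.cw ^ j) a = b}.Nonempty := by
    obtain ⟨n, hn⟩ := exists_pow_cw_eq (M := M) (a := M.cw a) (b := b) (by rw [M.cw_fst, h])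
    exact ⟨n + 1, by omega, by rw [pow_succ, Equiv.Perm.mul_apply, hn]⟩
  exact Nat.sInf_mem hne

theorem turn_le {a b : M.graph.Dart} {j : ℕ} (hj : 1 ≤ j) (h : (M.cw ^ j) a = b) :
    turn a b ≤ j := Nat.sInf_le ⟨hj, h⟩

theorem turn_eq {a b : M.graph.Dart} {j : ℕ} (hj : 1 ≤ j) (h : (M.cw ^ j) a = b)
    (hlt : ∀ i, 1 ≤ i → i < j → (M.cw ^ i) a ≠ b) : turn a b = j := by
  have hs := turn_spec (M := M) (a := a) (b := b) (by rw [← h, cw_pow_fst])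
  refine le_antisymm (turn_le hj h) ?_
  by_contra hlt'
  exact hlt _ hs.1 (by omega) hs.2

theorem cw_pow_add (i j : ℕ) (a : M.graph.Dart) :
    (M.cw ^ (i + j)) a = (M.cw ^ i) ((M.cw ^ j) a) := by
  rw [pow_add, Equiv.Perm.mul_apply]

theorem cw_pow_succ (i : ℕ) (a : M.graph.Dart) :
    (M.cw ^ (i + 1)) a = M.cw ((M.cw ^ i) a) := by
  rw [pow_succ', Equiv.Perm.mul_apply]

theorem cw_pow_inj {a b : M.graph.Dart} (h : a.fst = b.fst) {i j : ℕ} (hi : 1 ≤ i)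
    (hj : 1 ≤ j) (hi' : i ≤ turn a b) (hj' : j ≤ turn a b)
    (hij : (M.cw ^ i) a = (M.cw ^ j) a) : i = j := by
  have key : ∀ i j : ℕ, 1 ≤ i → i < j → j ≤ turn a b → (M.cw ^ i) a ≠ (M.cw ^ j) a := by
    intro i j hi hlt hj hij
    have h1 : (M.cw ^ (turn a b - j + i)) a = b := by
      rw [cw_pow_add, hij, ← cw_pow_add, Nat.sub_add_cancel hj, (turn_spec h).2]
    have := turn_le (by omega) h1
    omega
  rcases lt_trichotomy i j with hlt | heq | hlt
  · exact absurd hij (key i j hi hlt hj')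
  · exact heq
  · exact absurd hij.symm (key j i hj hlt hi')

/-- As zero steps are not allowed, `turn a a` is one full revolution, the degree of the vertex. -/
theorem turn_le_turn_self {a b : M.graph.Dart} (h : a.fst = b.fst) : turn a b ≤ turn a a := by
  obtain ⟨h1, h2⟩ := turn_spec (M := M) (a := a) (b := a) rfl
  have hper : ∀ q : ℕ, (M.cw ^ (turn a a * q)) a = a := by
    intro q
    induction q with
    | zero => simp
    | succ q ih => rw [mul_add, mul_one, cw_pow_add, h2, ih]
  have hmod : (M.cw ^ (turn a b % turn a a)) a = b := by
    conv_rhs => rw [← (turn_spec h).2, ← Nat.mod_add_div (turn a b) (turn a a), cw_pow_add, hper]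
  rcases Nat.eq_zero_or_pos (turn a b % turn a a) with h0 | h0
  · rw [h0, pow_zero, Equiv.Perm.one_apply] at hmod
    rw [← hmod]
  · exact (turn_le h0 hmod).trans (Nat.mod_lt _ (by omega)).le

/-- The sum of `w` over the darts strictly between `a` and `b` in clockwise order. -/
noncomputable def leftSum (w : M.graph.Dart → ℚ) (a b : M.graph.Dart) : ℚ :=
  ∑ l ∈ Finset.Ico 1 (turn a b), w ((M.cw ^ l) a)

theorem leftSum_sub (w w' : M.graph.Dart → ℚ) (a b : M.graph.Dart) :
    leftSum (w - w') a b = leftSum w a b - leftSum w' a b := Finset.sum_sub_distrib ..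

theorem leftSum_smul (c : ℚ) (w : M.graph.Dart → ℚ) (a b : M.graph.Dart) :
    leftSum (c • w) a b = c * leftSum w a b := (Finset.mul_sum ..).symm

theorem leftSum_nonneg {w : M.graph.Dart → ℚ} (hw : ∀ d, 0 ≤ w d) (a b : M.graph.Dart) :
    0 ≤ leftSum w a b := Finset.sum_nonneg fun _ _ => hw _

theorem leftSum_congr_of_ne {w w' : M.graph.Dart → ℚ} {a b : M.graph.Dart} (h : a.fst = b.fst)
    (hw : ∀ d, d.fst = b.fst → d ≠ a → d ≠ b → w d = w' d) : leftSum w a b = leftSum w' a b := by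
  have hle := turn_le_turn_self h
  refine Finset.sum_congr rfl fun l hl => hw _ (by rw [cw_pow_fst, h]) (fun hb => ?_) fun hb => ?_
  all_goals
    rw [Finset.mem_Ico] at hl
    have := turn_le hl.1 hb
    omega

theorem leftSum_congr {w w' : M.graph.Dart → ℚ} {a b : M.graph.Dart} (h : a.fst = b.fst)
    (hw : ∀ d, d.fst = b.fst → d ≠ b → w d = w' d) : leftSum w a b = leftSum w' a b :=
  leftSum_congr_of_ne h fun d hd _ hdb => hw d hd hdb

theorem leftSum_ite_eq {a b c : M.graph.Dart} (hab : a.fst = b.fst) (hc : a.fst = c.fst) :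
    leftSum (fun d => if d = c then 1 else 0) a b = if turn a c < turn a b then 1 else 0 := by
  obtain ⟨h1, h2⟩ := turn_spec hc
  rw [leftSum]
  split_ifs with h
  · rw [Finset.sum_eq_single (turn a c), if_pos h2]
    · intro l hl hne
      rw [if_neg]
      intro hlc
      rw [Finset.mem_Ico] at hl
      exact hne (cw_pow_inj hab hl.1 h1 hl.2.le h.le (hlc.trans h2.symm))
    · intro hl
      exact absurd (Finset.mem_Ico.2 ⟨h1, h⟩) hl
  · refine Finset.sum_eq_zero fun l hl => if_neg fun hlc => ?_
    rw [Finset.mem_Ico] at hl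
    have := turn_le hl.1 hlc
    omega

theorem le_leftSum {w : M.graph.Dart → ℚ} (hw : ∀ d, 0 ≤ w d) {a b : M.graph.Dart} {l : ℕ}
    (hl : 1 ≤ l) (hl' : l < turn a b) : w ((M.cw ^ l) a) ≤ leftSum w a b :=
  Finset.single_le_sum (f := fun l => w ((M.cw ^ l) a)) (fun _ _ => hw _)
    (Finset.mem_Ico.2 ⟨hl, hl'⟩)

theorem leftSum_zero (a b : M.graph.Dart) : leftSum 0 a b = 0 := Finset.sum_const_zero

theorem leftSum_telescope (F : M.graph.Dart → ℚ) {a b : M.graph.Dart} (h : a.fst = b.fst) :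
    leftSum (fun d => F (M.cw d) - F d) a b = F b - F (M.cw a) := by
  obtain ⟨h1, h2⟩ := turn_spec h
  have := Finset.sum_Ico_sub (fun l => F ((M.cw ^ l) a)) h1
  rw [h2, pow_one] at this
  rw [← this]
  refine Finset.sum_congr rfl fun l _ => ?_
  rw [cw_pow_succ]

theorem leftSum_add_last (w : M.graph.Dart → ℚ) {a b : M.graph.Dart} (h : a.fst = b.fst) :
    leftSum w a b + w b = ∑ l ∈ Finset.Ico 1 (turn a b + 1), w ((M.cw ^ l) a) := by
  obtain ⟨h1, h2⟩ := turn_spec h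
  rw [Finset.sum_Ico_succ_top h1, h2, leftSum]

theorem leftSum_add_le {w : M.graph.Dart → ℚ} (hw : ∀ d, 0 ≤ w d) {a b : M.graph.Dart}
    (h : a.fst = b.fst) :
    leftSum w a b + w b ≤ ∑ d : M.graph.Dart with d.fst = b.fst, w d := by
  rw [leftSum_add_last w h, ← Finset.sum_image (f := w) (g := fun l => (M.cw ^ l) a)]
  · refine Finset.sum_le_sum_of_subset_of_nonneg ?_ fun d _ _ => hw d
    intro d hd
    obtain ⟨l, _, rfl⟩ := Finset.mem_image.1 hd
    simp [h]
  · intro i hi j hj hij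
    rw [Finset.mem_coe, Finset.mem_Ico] at hi hj
    exact cw_pow_inj h hi.1 hj.1 (by omega) (by omega) hij

theorem sum_around (w : M.graph.Dart → ℚ) (a : M.graph.Dart) :
    ∑ l ∈ Finset.Ico 1 (turn a a + 1), w ((M.cw ^ l) a) =
      ∑ d : M.graph.Dart with d.fst = a.fst, w d := by
  rw [← Finset.sum_image (f := w) (g := fun l => (M.cw ^ l) a)]
  · refine Finset.sum_congr ?_ fun _ _ => rfl
    ext d
    simp only [Finset.mem_image, Finset.mem_Ico, Finset.mem_filter, Finset.mem_univ, true_and]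
    constructor
    · rintro ⟨l, _, rfl⟩
      simp
    · intro hd
      have hd' := turn_spec hd.symm
      exact ⟨_, ⟨hd'.1, Nat.lt_succ_of_le (turn_le_turn_self hd.symm)⟩, hd'.2⟩
  · intro i hi j hj hij
    rw [Finset.mem_coe, Finset.mem_Ico] at hi hj
    exact cw_pow_inj rfl hi.1 hj.1 (by omega) (by omega) hij

/-! ### Walks as flows -/

/-- The net number of times that a list of darts runs along a dart. -/
def net (l : List M.graph.Dart) (d : M.graph.Dart) : ℚ := (l.count d : ℚ) - l.count d.symm

theorem net_mem_antisymm (l : List M.graph.Dart) : net l ∈ M.antisymm := by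
  intro d
  rw [net, net, d.symm_symm]; ring

theorem net_nil : net ([] : List M.graph.Dart) = 0 := by
  ext d; simp [net]

theorem net_append (l l' : List M.graph.Dart) : net (l ++ l') = net l + net l' := by
  ext d; simp only [net, List.count_append, Pi.add_apply]; push_cast; ring

theorem net_cons (d : M.graph.Dart) (l : List M.graph.Dart) : net (d :: l) = net [d] + net l :=
  net_append [d] l

theorem net_singleton (d b : M.graph.Dart) :
    net [d] b = (if b = d then 1 else 0) - (if b = d.symm then 1 else 0) := by
  have : (b.symm = d) = (b = d.symm) := by
    rw [eq_iff_iff]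
    exact SimpleGraph.Dart.symm_involutive.eq_iff
  have h2 : (d = b) = (b = d) := by rw [eq_iff_iff, eq_comm]
  have h3 : (d = b.symm) = (b.symm = d) := by rw [eq_iff_iff, eq_comm]
  simp only [net, List.count_singleton, beq_iff_eq, h2, h3, this]
  push_cast
  rfl

theorem net_eq_zero {l : List M.graph.Dart} {b : M.graph.Dart} (h : b ∉ l) (h' : b.symm ∉ l) :
    net l b = 0 := by
  rw [net, List.count_eq_zero_of_not_mem h, List.count_eq_zero_of_not_mem h', sub_self]

theorem sum_net_mul (l : List M.graph.Dart) {w : M.graph.Dart → ℚ} (hw : w ∈ M.antisymm) :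
    ∑ b, net l b * w b = 2 * (l.map w).sum := by
  induction l with
  | nil => simp [net_nil]
  | cons d l ih =>
    rw [net_cons]
    simp only [Pi.add_apply, add_mul, Finset.sum_add_distrib, ih, net_singleton, sub_mul, ite_mul,
      one_mul, zero_mul, Finset.sum_sub_distrib, Finset.sum_ite_eq', Finset.mem_univ, if_true,
      List.map_cons, List.sum_cons, hw d]
    ring

theorem sum_net_walk {x y : V} (p : M.graph.Walk x y) (z : V) :
    ∑ d : M.graph.Dart with d.fst = z, net p.darts d =
      (if z = x then 1 else 0) - (if z = y then 1 else 0) := by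
  induction p with
  | nil => simp [net_nil]
  | @cons u v w h p ih =>
    rw [SimpleGraph.Walk.darts_cons, net_cons]
    simp only [Pi.add_apply, Finset.sum_add_distrib, ih]
    have : ∑ d : M.graph.Dart with d.fst = z, net [⟨(u, v), h⟩] d =
        (if z = u then 1 else 0) - (if z = v then 1 else 0) := by
      simp only [net_singleton, Finset.sum_sub_distrib]
      congr 1
      · rw [Finset.sum_ite_eq']
        simp [eq_comm]
      · rw [Finset.sum_ite_eq']
        simp [eq_comm]
    rw [this]; ring

/-! ### Potentials on corners -/

/-- Integrate `p` clockwise from a base dart chosen at each vertex; the vanishing total makes the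
integral close up on returning to the base. -/
theorem exists_cw_potential {p : M.graph.Dart → ℚ}
    (hp : ∀ x, ∑ d : M.graph.Dart with d.fst = x, p d = 0) :
    ∃ f : M.graph.Dart → ℚ, ∀ b, f (M.cw b) - f b = p b := by
  classical
  let base : V → Option M.graph.Dart := fun x =>
    if h : ∃ a : M.graph.Dart, a.fst = x then some h.choose else none
  have hb : ∀ d : M.graph.Dart, ∃ a, base d.fst = some a ∧ a.fst = d.fst := by
    intro d
    have h : ∃ a : M.graph.Dart, a.fst = d.fst := ⟨d, rfl⟩
    exact ⟨h.choose, dif_pos h, h.choose_spec⟩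
  refine ⟨fun d => (base d.fst).elim 0 fun a => leftSum p a d, fun b => ?_⟩
  obtain ⟨a, ha, hab⟩ := hb b
  simp only [M.cw_fst, ha, Option.elim_some]
  obtain ⟨h1, h2⟩ := turn_spec hab
  by_cases hba : b = a
  · subst hba
    have ht : turn b (M.cw b) = 1 := turn_eq le_rfl (by simp) (by omega)
    have hs := sum_around p b
    rw [hp, ← leftSum_add_last p rfl] at hs
    rw [leftSum, ht, Finset.Ico_self, Finset.sum_empty]
    linarith
  · have ht : turn a (M.cw b) = turn a b + 1 := by
      refine turn_eq (by omega) (by rw [cw_pow_succ, h2]) fun i hi hlt heq => ?_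
      obtain ⟨i, rfl⟩ : ∃ j, i = j + 1 := ⟨i - 1, by omega⟩
      rw [cw_pow_succ] at heq
      have heq := M.cw.injective heq
      rcases Nat.eq_zero_or_pos i with rfl | hi0
      · exact hba heq.symm
      · have := turn_le hi0 heq
        omega
    rw [leftSum, ht, ← leftSum_add_last p hab]
    ring

theorem sum_leftFace_comp_faceNext (F : M.graph.Dart → ℚ) (f : M.Face) :
    ∑ d : M.graph.Dart with M.leftFace d = f, F (M.faceNext d) =
      ∑ d : M.graph.Dart with M.leftFace d = f, F d := by
  rw [Finset.sum_filter, Finset.sum_filter,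
    ← sum_comp_faceNext (fun d => if M.leftFace d = f then F d else 0)]
  simp

/-- A potential for rotations alone is determined up to a constant at each vertex. `hpq` makes its
error along the faces antisymmetric and `hq` makes it circulation-free, so the error is a gradient
and these constants can correct it. -/
theorem exists_potential {p q : M.graph.Dart → ℚ}
    (hp : ∀ x, ∑ d : M.graph.Dart with d.fst = x, p d = 0)
    (hq : ∀ f, ∑ d : M.graph.Dart with M.leftFace d = f, q d = 0)
    (hpq : ∀ d, p d + p d.symm = q d + q d.symm) :
    ∃ f : M.graph.Dart → ℚ, (∀ b, f (M.cw b) - f b = p b) ∧ ∀ d, f (M.faceNext d) - f d = q d := by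
  obtain ⟨f₀, hf₀⟩ := exists_cw_potential hp
  have ha : (fun d => q d - f₀ (M.faceNext d) + f₀ d) ∈ M.antisymm := by
    intro d
    have h1 := hf₀ d
    have h2 := hf₀ d.symm
    have h3 := hpq d
    simp only [faceNext_apply, d.symm_symm]
    linarith
  obtain ⟨φ, hφ⟩ := exists_vertexDiff_eq ha (fun f => by
    rw [Finset.sum_add_distrib, Finset.sum_sub_distrib, sum_leftFace_comp_faceNext, hq]
    ring)
  refine ⟨fun d => f₀ d + φ d.fst, fun b => ?_, fun d => ?_⟩
  · beta_reduce
    rw [M.cw_fst, ← hf₀ b]; ring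
  · have := congrFun hφ d
    rw [vertexDiff_apply] at this
    beta_reduce
    rw [faceNext_fst]
    linarith

/-! ### Reference flows to `A` and their disks -/

/-- A choice, for every vertex, of a unit flow from it to `A` and, for every dart, of a function on
the faces bounded by the dart and the flows from its ends. -/
structure Reference (M : PlanarMap V) (A : V) (r : M.Face) where
  flow : V → M.graph.Dart → ℚ
  flow_antisymm : ∀ x, flow x ∈ M.antisymm
  flow_div : ∀ x z, ∑ d : M.graph.Dart with d.fst = z, flow x d =
    (if z = x then 1 else 0) - (if z = A then 1 else 0)
  flow_root : flow A = 0
  disk : M.graph.Dart → M.Face → ℚ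
  faceDiff_disk : ∀ d, M.faceDiff (disk d) = net [d] + flow d.snd - flow d.fst
  disk_root : ∀ d, disk d r = 0

theorem exists_faceDiff_eq_of_root {a : M.graph.Dart → ℚ} (ha : a ∈ M.antisymm)
    (hdiv : ∀ x, ∑ d : M.graph.Dart with d.fst = x, a d = 0) (r : M.Face) :
    ∃ h, M.faceDiff h = a ∧ h r = 0 := by
  obtain ⟨h, hh⟩ := exists_faceDiff_eq ha hdiv
  refine ⟨fun f => h f - h r, ?_, sub_self _⟩
  rw [← hh]
  ext d
  simp only [faceDiff_apply]
  ring

theorem nonempty_reference (A : V) (r : M.Face) : Nonempty (Reference M A r) := by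
  have hw : ∀ x, ∃ w : M.graph.Walk x A, x = A → w.darts = [] := by
    intro x
    by_cases h : x = A
    · subst h; exact ⟨.nil, fun _ => rfl⟩
    · obtain ⟨w⟩ := M.connected.preconnected x A
      exact ⟨w, fun h' => absurd h' h⟩
  choose w hwA using hw
  have hK : ∀ d : M.graph.Dart, ∃ h : M.Face → ℚ,
      M.faceDiff h = net [d] + net (w d.snd).darts - net (w d.fst).darts ∧ h r = 0 := by
    intro d
    refine exists_faceDiff_eq_of_root (sub_mem (add_mem (net_mem_antisymm _) (net_mem_antisymm _))
      (net_mem_antisymm _)) (fun z => ?_) r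
    have h1 := sum_net_walk d.adj.toWalk z
    have h2 : (d.adj.toWalk).darts = [d] := rfl
    rw [h2] at h1
    simp only [Pi.sub_apply, Pi.add_apply, Finset.sum_sub_distrib, Finset.sum_add_distrib, h1,
      sum_net_walk]
    ring
  choose K hK hKr using hK
  exact ⟨⟨fun x => net (w x).darts, fun x => net_mem_antisymm _, fun x z => sum_net_walk _ _,
    by simp only [hwA A rfl, net_nil], K, hK, hKr⟩⟩

namespace Reference

variable {A : V} {r : M.Face} (R : Reference M A r)

theorem disk_symm (d : M.graph.Dart) : R.disk d.symm = -R.disk d := by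
  refine eq_of_faceDiff_eq (r := r) ?_ (by simp [R.disk_root])
  rw [map_neg, R.faceDiff_disk, R.faceDiff_disk]
  have h1 : d.symm.snd = d.fst := rfl
  have h2 : d.symm.fst = d.snd := rfl
  ext b
  simp only [Pi.add_apply, Pi.sub_apply, Pi.neg_apply, net_singleton, d.symm_symm, h1, h2]
  ring

/-- Around the boundary of `f` the flows cancel in pairs, leaving the winding function of that
boundary, normalised to vanish at `r`. This is why three disks per face cancel a face sum of -3. -/
theorem sum_disk (f : M.Face) : ∑ d : M.graph.Dart with M.leftFace d = f, R.disk d f =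
    if f = r then 0 else 1 := by
  have key : ∑ d : M.graph.Dart with M.leftFace d = f, R.disk d =
      fun g => (if g = f then 1 else 0) - (if r = f then 1 else 0) := by
    refine eq_of_faceDiff_eq (r := r) ?_ (by simp [R.disk_root])
    rw [map_sum]
    ext b
    simp only [R.faceDiff_disk, Finset.sum_apply, Pi.add_apply, Pi.sub_apply,
      Finset.sum_sub_distrib, Finset.sum_add_distrib, faceDiff_apply]
    have h1 : ∑ d : M.graph.Dart with M.leftFace d = f, R.flow d.snd b =
        ∑ d : M.graph.Dart with M.leftFace d = f, R.flow d.fst b := by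
      rw [← sum_leftFace_comp_faceNext (fun d => R.flow d.fst b)]
      simp
    have h2 : ∑ d : M.graph.Dart with M.leftFace d = f, net [d] b =
        (if M.leftFace b = f then 1 else 0) - (if M.leftFace b.symm = f then 1 else 0) := by
      have : ∀ d : M.graph.Dart, (b = d.symm) = (d = b.symm) := by
        intro d
        rw [eq_iff_iff, eq_comm]
        exact SimpleGraph.Dart.symm_involutive.eq_iff
      have h3 : ∀ d : M.graph.Dart, (b = d) = (d = b) := fun d => by rw [eq_iff_iff, eq_comm]
      simp only [net_singleton, Finset.sum_sub_distrib, this, h3]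
      rw [Finset.sum_ite_eq', Finset.sum_ite_eq']
      simp
    rw [h1, h2]
    ring
  have := congrFun key f
  rw [Finset.sum_apply] at this
  rw [this]
  by_cases h : f = r
  · simp [h]
  · simp [h, Ne.symm h]

/-- The winding function of a list of darts, closed up by the flows from its ends. -/
def wind (l : List M.graph.Dart) : M.Face → ℚ := (l.map R.disk).sum

theorem wind_cons (d : M.graph.Dart) (l : List M.graph.Dart) :
    R.wind (d :: l) = R.disk d + R.wind l := by simp [wind]

theorem wind_nil : R.wind [] = 0 := rfl

theorem wind_root (l : List M.graph.Dart) : R.wind l r = 0 := by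
  induction l with
  | nil => rfl
  | cons d l ih => rw [wind_cons, Pi.add_apply, ih, R.disk_root, add_zero]

theorem faceDiff_wind {x y : V} (p : M.graph.Walk x y) :
    M.faceDiff (R.wind p.darts) = net p.darts + R.flow y - R.flow x := by
  induction p with
  | nil => simp [wind_nil, net_nil]
  | @cons u v w h p ih =>
    rw [SimpleGraph.Walk.darts_cons, wind_cons, map_add, ih, net_cons, R.faceDiff_disk]
    ring_nf

/-- A function on the corners which changes by `o b - 3 * flow b` when crossing the dart `b`
clockwise around its origin, and by `σ d + 3 * disk d` when following the left side of `d`. -/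
structure IsPotential (o σ f : M.graph.Dart → ℚ) : Prop where
  cw : ∀ b, f (M.cw b) - f b = o b - 3 * R.flow b.fst b
  faceNext : ∀ d, f (M.faceNext d) - f d = σ d + 3 * R.disk d (M.leftFace d)

/-- The flow and disk terms bring the sums at vertices and faces to zero. The constant 3 in `hoσ` is
three times the unit jump of `disk d` across `d`; the rest of that jump cancels against the flow
terms. -/
theorem exists_isPotential {o σ : M.graph.Dart → ℚ}
    (ho : ∀ x, ∑ d : M.graph.Dart with d.fst = x, o d = if x = A then 0 else 3)
    (hσ : ∀ f, ∑ d : M.graph.Dart with M.leftFace d = f, σ d = if f = r then 0 else -3)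
    (hoσ : ∀ d, o d + o d.symm = σ d + σ d.symm + 3) : ∃ f, R.IsPotential o σ f := by
  have key := exists_potential (M := M) (p := fun b => o b - 3 * R.flow b.fst b)
    (q := fun d => σ d + 3 * R.disk d (M.leftFace d)) ?_ ?_ ?_
  · obtain ⟨f, h1, h2⟩ := key
    exact ⟨f, h1, h2⟩
  · intro x
    have : ∑ d : M.graph.Dart with d.fst = x, R.flow d.fst d = if x = A then 0 else 1 := by
      rw [Finset.sum_congr rfl (g := fun d => R.flow x d), R.flow_div]
      · by_cases h : x = A <;> simp [h]
      · intro d hd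
        rw [(Finset.mem_filter.1 hd).2]
    rw [Finset.sum_sub_distrib, ← Finset.mul_sum, this, ho]
    split_ifs <;> norm_num
  · intro f
    have : ∑ d : M.graph.Dart with M.leftFace d = f, R.disk d (M.leftFace d) =
        if f = r then 0 else 1 := by
      rw [← R.sum_disk f]
      refine Finset.sum_congr rfl fun d hd => ?_
      rw [(Finset.mem_filter.1 hd).2]
    rw [Finset.sum_add_distrib, ← Finset.mul_sum, this, hσ]
    split_ifs <;> norm_num
  · intro d
    have h1 : d.symm.fst = d.snd := rfl
    have h2 := congrFun (R.faceDiff_disk d) d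
    have h3 : d ≠ d.symm := d.symm_ne.symm
    simp only [faceDiff_apply, Pi.add_apply, Pi.sub_apply, net_singleton, if_true, if_neg h3] at h2
    rw [R.disk_symm, h1, R.flow_antisymm d.snd d, Pi.neg_apply]
    linarith [hoσ d]

end Reference

/-! ### The Gauss–Bonnet identity along a chain -/

/-- Linked darts such that the tail never comes back to the end of a dart that has been followed. -/
def IsSimpleChain : List M.graph.Dart → Prop
  | [] => True
  | [_] => True
  | d :: d' :: l => d.snd = d'.fst ∧ (∀ b ∈ l, b.fst ≠ d'.fst) ∧ (∀ b ∈ d' :: l, b.snd ≠ d'.fst) ∧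
      IsSimpleChain (d' :: l)

/-- The sum of `w` over the darts that leave a list of linked darts strictly to its left. -/
noncomputable def turnSum (w : M.graph.Dart → ℚ) : List M.graph.Dart → ℚ
  | [] => 0
  | [_] => 0
  | d :: d' :: l => leftSum w d.symm d' + turnSum w (d' :: l)

namespace Reference

variable {A : V} {r : M.Face} (R : Reference M A r)

theorem faceDiff_wind_of_isSimpleChain (d : M.graph.Dart) (l : List M.graph.Dart)
    (hl : IsSimpleChain (d :: l)) : M.faceDiff (R.wind (d :: l)) =
      net (d :: l) + R.flow ((d :: l).getLast (List.cons_ne_nil _ _)).snd - R.flow d.fst := by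
  induction l generalizing d with
  | nil => rw [wind_cons, wind_nil, add_zero, R.faceDiff_disk]; rfl
  | cons d' l ih =>
    obtain ⟨h1, -, -, h4⟩ := hl
    rw [wind_cons, map_add, ih d' h4, net_cons d (d' :: l), R.faceDiff_disk, List.getLast_cons_cons, h1]
    ring_nf

/-- Walk along the left side of the chain, alternating one step along a face with one rotation
through the left sector of the next turn. The flow picked up in such a sector is exchanged for the
change of the winding function of the remaining chain. Only the start of the chain may be revisited,
so a cycle cut open at a vertex is allowed. -/
theorem potential_sub_eq {o σ f : M.graph.Dart → ℚ} (hf : R.IsPotential o σ f)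
    (d : M.graph.Dart) (l : List M.graph.Dart) (hl : IsSimpleChain (d :: l)) :
    f d - f (M.faceNext ((d :: l).getLast (List.cons_ne_nil _ _))) =
      - ((d :: l).map σ).sum - turnSum o (d :: l) - 3 * R.wind (d :: l) (M.leftFace d)
      + 3 * turnSum (R.flow ((d :: l).getLast (List.cons_ne_nil _ _)).snd) (d :: l) := by
  induction l generalizing d with
  | nil =>
    have := hf.faceNext d
    simp only [List.getLast_singleton, List.map_cons, List.map_nil, List.sum_cons, List.sum_nil,
      turnSum, wind_cons, wind_nil, add_zero]
    linarith
  | cons d' l ih =>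
    have hd := R.faceDiff_wind_of_isSimpleChain d' l hl.2.2.2
    obtain ⟨h1, h2, h3, h4⟩ := hl
    have ih := ih d' h4
    rw [List.getLast_cons_cons]
    set z := (d' :: l).getLast (List.cons_ne_nil _ _) with hz
    have hfst : d.symm.fst = d'.fst := h1
    have e1 := leftSum_telescope f hfst
    have e2 := leftSum_telescope (fun b => R.wind (d' :: l) (M.leftFace b)) hfst
    -- The remaining chain meets this vertex only in `d'`, so inside the sector its winding function
    -- changes by the flows alone.
    have e3 : leftSum (fun b => R.wind (d' :: l) (M.leftFace (M.cw b)) -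
        R.wind (d' :: l) (M.leftFace b)) d.symm d' =
        leftSum (R.flow d'.fst - R.flow z.snd) d.symm d' := by
      refine leftSum_congr hfst fun b hb hbd => ?_
      have hn : net (d' :: l) b = 0 := by
        refine net_eq_zero ?_ fun hmem => h3 _ hmem hb
        rw [List.mem_cons, not_or]
        exact ⟨hbd, fun hmem => h2 _ hmem hb⟩
      have := congrFun hd b
      rw [faceDiff_apply, Pi.sub_apply, Pi.add_apply, hn] at this
      rw [leftFace_cw, Pi.sub_apply]
      linarith
    have e4 : leftSum (fun b => f (M.cw b) - f b) d.symm d' =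
        leftSum (o - (3 : ℚ) • R.flow d'.fst) d.symm d' := by
      refine leftSum_congr hfst fun b hb hbd => ?_
      rw [hf.cw b, hb]
      rfl
    rw [e3, leftSum_sub] at e2
    rw [e4, leftSum_sub, leftSum_smul] at e1
    have e5 := hf.faceNext d
    rw [faceNext_apply] at e5
    rw [← faceNext_apply, leftFace_faceNext] at e2
    simp only [List.map_cons, List.sum_cons, turnSum, R.wind_cons d, Pi.add_apply] at ih ⊢
    linarith

end Reference

/-! ### Triangular faces and the weights of a 3-orientation -/

theorem leftFace_eq_iff {c d : M.graph.Dart} :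
    M.leftFace c = M.leftFace d ↔ M.faceNext.SameCycle c d :=
  ⟨fun h => Quotient.exact h, fun h => Quotient.sound h⟩

theorem ne_faceNext (d : M.graph.Dart) : d ≠ M.faceNext d := by
  intro h
  have h1 := congrArg (fun b : M.graph.Dart => b.fst) h
  simp only [faceNext_fst] at h1
  exact d.fst_ne_snd h1

theorem card_leftFace (hM : M.IsTriangulation) (f : M.Face) :
    (Finset.univ.filter fun c : M.graph.Dart => M.leftFace c = f).card = 3 := by
  rw [← hM f, Nat.card_eq_fintype_card, Fintype.card_subtype]
  rfl

theorem filter_leftFace_eq (hM : M.IsTriangulation) (d : M.graph.Dart) :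
    (Finset.univ.filter fun c : M.graph.Dart => M.leftFace c = M.leftFace d) =
      {d, M.faceNext d, M.faceNext (M.faceNext d)} := by
  have hcard := card_leftFace hM (M.leftFace d)
  have h2 : M.faceNext (M.faceNext d) ≠ d := by
    intro h
    have hsub : (Finset.univ.filter fun c : M.graph.Dart => M.leftFace c = M.leftFace d) ⊆
        {d, M.faceNext d} := by
      intro c hc
      obtain ⟨n, rfl⟩ := (leftFace_eq_iff.1 (Finset.mem_filter.1 hc).2.symm).exists_nat_pow_eq
      clear hc
      induction n with
      | zero => simp
      | succ n ih =>
        rw [pow_succ', Equiv.Perm.mul_apply]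
        rw [Finset.mem_insert, Finset.mem_singleton] at ih ⊢
        rcases ih with ih | ih
        · right; rw [ih]
        · left; rw [ih, h]
    have := (Finset.card_le_card hsub).trans Finset.card_le_two
    omega
  symm
  apply Finset.eq_of_subset_of_card_le
  · intro c hc
    simp only [Finset.mem_insert, Finset.mem_singleton] at hc
    rcases hc with rfl | rfl | rfl <;> simp
  · rw [hcard, Finset.card_eq_three.2 ⟨d, _, _, ne_faceNext d, h2.symm, ne_faceNext _, rfl⟩]

theorem leftFace_eq_iff_of_isTriangulation (hM : M.IsTriangulation) {c d : M.graph.Dart} :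
    M.leftFace c = M.leftFace d ↔
      c = d ∨ c = M.faceNext d ∨ c = M.faceNext (M.faceNext d) := by
  have := Finset.ext_iff.1 (filter_leftFace_eq hM d) c
  simpa using this

theorem faceNext_ne (hM : M.IsTriangulation) (d : M.graph.Dart) :
    M.faceNext (M.faceNext d) ≠ d := by
  intro h
  have h1 := card_leftFace hM (M.leftFace d)
  rw [filter_leftFace_eq hM d, h] at h1
  have := (Finset.card_le_card (t := {d, M.faceNext d}) (s := {d, M.faceNext d, d})
    (by intro c; simp; tauto)).trans Finset.card_le_two
  omega

theorem faceNext_faceNext_faceNext (hM : M.IsTriangulation) (d : M.graph.Dart) :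
    M.faceNext (M.faceNext (M.faceNext d)) = d := by
  have h : M.leftFace (M.faceNext (M.faceNext (M.faceNext d))) = M.leftFace d := by simp
  rcases (leftFace_eq_iff_of_isTriangulation hM).1 h with h | h | h
  · exact h
  · exact absurd (M.faceNext.injective h) (faceNext_ne hM d)
  · exact absurd (M.faceNext.injective (M.faceNext.injective h)) (ne_faceNext d).symm



theorem faceNext_faceNext_snd (hM : M.IsTriangulation) (ξ : M.Corner) :
    (M.faceNext (M.faceNext ξ)).snd = M.cornerVertex ξ := by
  rw [← faceNext_fst, faceNext_faceNext_faceNext hM]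
  rfl

theorem faceNext_faceNext_fst (ξ : M.Corner) :
    (M.faceNext (M.faceNext ξ)).fst = M.vertexB ξ := faceNext_fst _

theorem cornerVertex_ne_vertexA (ξ : M.Corner) : M.cornerVertex ξ ≠ M.vertexA ξ := ξ.fst_ne_snd

theorem vertexB_ne_vertexA (ξ : M.Corner) : M.vertexB ξ ≠ M.vertexA ξ := by
  have := (M.faceNext ξ).snd_ne_fst
  rwa [faceNext_fst] at this

theorem vertexB_ne_cornerVertex (hM : M.IsTriangulation) (ξ : M.Corner) :
    M.vertexB ξ ≠ M.cornerVertex ξ := by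
  have := (M.faceNext (M.faceNext ξ)).fst_ne_snd
  rwa [faceNext_faceNext_snd hM, faceNext_faceNext_fst] at this


open Classical in
/-- The outgoing darts of `O`, with one more at `v` and two more at `B`. -/
noncomputable def outWeight (ξ : M.Corner) (O : Set M.graph.Dart) (d : M.graph.Dart) : ℚ :=
  (if d ∈ O then 1 else 0) + ((if d = ξ then 1 else 0) + (if d.symm = M.faceNext ξ then 1 else 0)
    + (if d = M.faceNext (M.faceNext ξ) then 1 else 0))

/-- The cost of a side of a dart: `0` in the root face and `-1` in the other faces. -/
noncomputable def sideWeight (ξ : M.Corner) (d : M.graph.Dart) : ℚ :=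
  -1 + if M.leftFace d = M.cornerFace ξ then 1 else 0

theorem outWeight_nonneg (ξ : M.Corner) (O : Set M.graph.Dart) (d : M.graph.Dart) :
    0 ≤ outWeight ξ O d := by
  unfold outWeight; positivity

theorem one_le_outWeight (ξ : M.Corner) {O : Set M.graph.Dart} {d : M.graph.Dart} (hd : d ∈ O) :
    1 ≤ outWeight ξ O d := by
  unfold outWeight
  rw [if_pos hd]
  have : (0 : ℚ) ≤ (if d = ξ then 1 else 0) + (if d.symm = M.faceNext ξ then 1 else 0)
    + (if d = M.faceNext (M.faceNext ξ) then 1 else 0) := by positivity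
  linarith

theorem sideWeight_nonpos (ξ : M.Corner) (d : M.graph.Dart) : sideWeight ξ d ≤ 0 := by
  unfold sideWeight; split_ifs <;> norm_num

theorem neg_one_le_sideWeight (ξ : M.Corner) (d : M.graph.Dart) : -1 ≤ sideWeight ξ d := by
  unfold sideWeight; split_ifs <;> norm_num

open Classical in
theorem sum_out (O : Set M.graph.Dart) (x : V) :
    ∑ d : M.graph.Dart with d.fst = x, (if d ∈ O then (1 : ℚ) else 0) = M.outdeg O x := by
  rw [Finset.sum_boole, Finset.filter_filter, outdeg, Nat.card_eq_fintype_card,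
    Fintype.card_subtype]
  congr 2
  ext d
  simp [and_comm]

namespace IsThreeOrientation

variable {ξ : M.Corner} {O : Set M.graph.Dart}

theorem notMem_of_fst_eq (hO : M.IsThreeOrientation ξ O) {d : M.graph.Dart}
    (hd : d.fst = M.vertexA ξ) : d ∉ O := by
  intro hdO
  have h := hO.outdeg_A
  have : Nonempty {d : M.graph.Dart // d ∈ O ∧ d.fst = M.vertexA ξ} := ⟨⟨d, hdO, hd⟩⟩
  have := Nat.card_pos (α := {d : M.graph.Dart // d ∈ O ∧ d.fst = M.vertexA ξ})
  rw [outdeg] at h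
  omega

theorem mem_of_snd_eq (hO : M.IsThreeOrientation ξ O) {d : M.graph.Dart}
    (hd : d.snd = M.vertexA ξ) : d ∈ O :=
  (hO.isOrientation d).2 (hO.notMem_of_fst_eq hd)

theorem symm_notMem (hO : M.IsThreeOrientation ξ O) {d : M.graph.Dart} (hd : d ∈ O) :
    d.symm ∉ O := (hO.isOrientation d).1 hd

theorem root_mem (hO : M.IsThreeOrientation ξ O) : ξ ∈ O := hO.mem_of_snd_eq rfl

theorem faceNext_symm_mem (hO : M.IsThreeOrientation ξ O) : (M.faceNext ξ).symm ∈ O :=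
  hO.mem_of_snd_eq (faceNext_fst ξ)

theorem faceNext_notMem (hO : M.IsThreeOrientation ξ O) : M.faceNext ξ ∉ O :=
  hO.notMem_of_fst_eq (faceNext_fst ξ)

theorem faceNext_faceNext_notMem (hM : M.IsTriangulation) (hO : M.IsThreeOrientation ξ O) :
    M.faceNext (M.faceNext ξ) ∉ O := by
  intro h
  have h1 := hO.outdeg_B
  rw [outdeg, Nat.card_eq_one_iff_unique] at h1
  have := h1.1.elim ⟨_, h, faceNext_faceNext_fst ξ⟩ ⟨_, hO.faceNext_symm_mem, rfl⟩
  have h2 := congrArg (fun b => b.1.snd) this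
  change (M.faceNext (M.faceNext ξ)).snd = (M.faceNext ξ).fst at h2
  rw [faceNext_faceNext_snd hM, faceNext_fst] at h2
  exact cornerVertex_ne_vertexA ξ h2

theorem sum_outWeight (hM : M.IsTriangulation) (hO : M.IsThreeOrientation ξ O) (x : V) :
    ∑ d : M.graph.Dart with d.fst = x, outWeight ξ O d = if x = M.vertexA ξ then 0 else 3 := by
  classical
  have hone : ∀ b : M.graph.Dart, ∑ d : M.graph.Dart with d.fst = x, (if d = b then (1 : ℚ) else 0) =
      if x = b.fst then 1 else 0 := by
    intro b
    rw [Finset.sum_ite_eq']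
    simp [eq_comm]
  have hsymm : ∀ d : M.graph.Dart, (d.symm = M.faceNext ξ) = (d = (M.faceNext ξ).symm) := by
    intro d
    rw [eq_iff_iff]
    exact SimpleGraph.Dart.symm_involutive.eq_iff
  have h1 : (M.faceNext ξ).symm.fst = M.vertexB ξ := rfl
  have h2 : ξ.fst = M.cornerVertex ξ := rfl
  unfold outWeight
  simp only [Finset.sum_add_distrib, hsymm, hone, h1, faceNext_faceNext_fst, h2]
  rw [sum_out]
  by_cases hA : x = M.vertexA ξ
  · rw [hA, hO.outdeg_A]
    simp [(cornerVertex_ne_vertexA ξ).symm, (vertexB_ne_vertexA ξ).symm]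
  · by_cases hB : x = M.vertexB ξ
    · rw [hB, hO.outdeg_B]
      simp [vertexB_ne_vertexA ξ, vertexB_ne_cornerVertex hM ξ]
      norm_num
    · by_cases hv : x = M.cornerVertex ξ
      · rw [hv, hO.outdeg_v]
        simp [cornerVertex_ne_vertexA ξ, (vertexB_ne_cornerVertex hM ξ).symm]
        norm_num
      · rw [hO.outdeg_inner x hA hB hv]
        simp [hA, hB, hv]

/-- An ordinary edge reads `1 = -2 + 3`. A root edge has one side that costs nothing, which is
balanced by its extra unit: `2 = -1 + 3`. -/
theorem outWeight_add_symm (hM : M.IsTriangulation) (hO : M.IsThreeOrientation ξ O)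
    (d : M.graph.Dart) :
    outWeight ξ O d + outWeight ξ O d.symm = sideWeight ξ d + sideWeight ξ d.symm + 3 := by
  classical
  have hroot : ∀ d : M.graph.Dart, (if M.leftFace d = M.cornerFace ξ then (1 : ℚ) else 0) =
      (if d = ξ then 1 else 0) + (if d = M.faceNext ξ then 1 else 0) +
        (if d = M.faceNext (M.faceNext ξ) then 1 else 0) := by
    intro d
    have h := leftFace_eq_iff_of_isTriangulation hM (c := d) (d := ξ)
    have h1 := ne_faceNext ξ
    have h2 := ne_faceNext (M.faceNext ξ)
    have h3 := faceNext_ne hM ξ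
    unfold cornerFace
    by_cases e1 : d = ξ
    · subst e1; simp [h1, h3.symm]
    · by_cases e2 : d = M.faceNext ξ
      · subst e2; simp [h1.symm, h2]
      · by_cases e3 : d = M.faceNext (M.faceNext ξ)
        · subst e3; simp [h3, h2.symm]
        · simp [h, e1, e2, e3]
  have hor : (if d ∈ O then (1 : ℚ) else 0) + (if d.symm ∈ O then (1 : ℚ) else 0) = 1 := by
    have := hO.isOrientation d
    by_cases h : d ∈ O
    · simp [h, this.1 h]
    · have h' : d.symm ∈ O := by by_contra h'; exact h (this.2 h')
      simp [h, h']
  unfold outWeight sideWeight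
  rw [hroot, hroot, d.symm_symm]
  linarith

end IsThreeOrientation

theorem sum_sideWeight (hM : M.IsTriangulation) (ξ : M.Corner) (f : M.Face) :
    ∑ d : M.graph.Dart with M.leftFace d = f, sideWeight ξ d =
      if f = M.cornerFace ξ then 0 else -3 := by
  rw [Finset.sum_congr rfl (g := fun _ => (-1 + if f = M.cornerFace ξ then 1 else 0 : ℚ))]
  · rw [Finset.sum_const, card_leftFace hM]
    split_ifs <;> norm_num
  · intro d hd
    rw [sideWeight, (Finset.mem_filter.1 hd).2]

theorem isSimpleChain_cons_darts {d : M.graph.Dart} {y z : V} (p : M.graph.Walk y z)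
    (hp : p.IsPath) (hd : d.snd = y) : IsSimpleChain (d :: p.darts) := by
  induction p generalizing d with
  | nil => trivial
  | @cons u v w h p ih =>
    rw [SimpleGraph.Walk.darts_cons]
    obtain ⟨hp, hu⟩ := (SimpleGraph.Walk.cons_isPath_iff h p).1 hp
    refine ⟨hd, fun b hb hbu => hu ?_, fun b hb hbu => hu ?_, ih hp rfl⟩
    · rw [← show b.fst = u from hbu]
      exact p.dart_fst_mem_support_of_mem_darts hb
    · rw [← show b.snd = u from hbu]
      rcases List.mem_cons.1 hb with rfl | hb
      · exact p.start_mem_support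
      · exact p.dart_snd_mem_support_of_mem_darts hb

/-! ### The left side of a simple cycle -/

/-- Distinct darts of the list have distinct origins and distinct ends. -/
def IsRegular (l : List M.graph.Dart) : Prop :=
  (l.map fun d => d.fst).Nodup ∧ (l.map fun d => d.snd).Nodup

namespace IsRegular

variable {l : List M.graph.Dart}

theorem nodup (hl : IsRegular l) : l.Nodup := List.Nodup.of_map _ hl.1

theorem fst_inj (hl : IsRegular l) {a b : M.graph.Dart} (ha : a ∈ l) (hb : b ∈ l)
    (h : a.fst = b.fst) : a = b := List.inj_on_of_nodup_map hl.1 ha hb h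

theorem snd_inj (hl : IsRegular l) {a b : M.graph.Dart} (ha : a ∈ l) (hb : b ∈ l)
    (h : a.snd = b.snd) : a = b := List.inj_on_of_nodup_map hl.2 ha hb h

theorem count_eq (hl : IsRegular l) (b : M.graph.Dart) : l.count b = if b ∈ l then 1 else 0 := by
  split_ifs with h
  · exact List.count_eq_one_of_mem hl.nodup h
  · exact List.count_eq_zero_of_not_mem h

theorem net_eq (hl : IsRegular l) {a b c : M.graph.Dart} (ha : a ∈ l) (hb : b ∈ l)
    (hab : a.snd = b.fst) (hc : c.fst = b.fst) :
    net l c = (if c = b then 1 else 0) - (if c = a.symm then 1 else 0) := by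
  have h1 : c ∈ l ↔ c = b := ⟨fun h => hl.fst_inj h hb hc, fun h => h ▸ hb⟩
  have h2 : c.symm ∈ l ↔ c = a.symm := by
    constructor
    · intro h
      rw [← hl.snd_inj (a := c.symm) (b := a) h ha (hc.trans hab.symm), c.symm_symm]
    · rintro rfl
      rwa [a.symm_symm]
  rw [net, hl.count_eq, hl.count_eq]
  simp only [h1, h2]
  push_cast
  rfl

end IsRegular

theorem isRegular_of_isPath {x y : V} {p : M.graph.Walk x y} (hp : p.IsPath) :
    IsRegular p.darts := by
  constructor
  · rw [p.map_fst_darts]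
    exact hp.support_nodup.sublist (List.dropLast_sublist _)
  · rw [p.map_snd_darts]
    exact hp.support_nodup.sublist (List.tail_sublist _)

theorem isRegular_of_isCycle {x : V} {p : M.graph.Walk x x} (hp : p.IsCycle) :
    IsRegular p.darts := by
  constructor
  · rw [p.map_fst_darts]
    exact hp.nodup_dropLast_support
  · rw [p.map_snd_darts]
    exact hp.support_nodup

theorem turnSum_concat (w : M.graph.Dart → ℚ) (d b : M.graph.Dart) (l : List M.graph.Dart) :
    turnSum w (d :: (l ++ [b])) = turnSum w (d :: l) +
      leftSum w ((d :: l).getLast (List.cons_ne_nil _ _)).symm b := by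
  induction l generalizing d with
  | nil => simp [turnSum]
  | cons d' l ih =>
    rw [List.cons_append, turnSum, ih, turnSum, List.getLast_cons_cons]
    ring

theorem turnSum_add_sum {w G : M.graph.Dart → ℚ} (d : M.graph.Dart) (l : List M.graph.Dart)
    (h : (d :: l).IsChain fun a b => leftSum w a.symm b + w b = G b) :
    turnSum w (d :: l) + (l.map w).sum = (l.map G).sum := by
  induction l generalizing d with
  | nil => simp [turnSum]
  | cons d' l ih =>
    rw [List.isChain_cons_cons] at h
    have := ih d' h.2
    rw [turnSum, List.map_cons, List.map_cons, List.sum_cons, List.sum_cons]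
    linarith [h.1]

theorem turnSum_eq_zero {w : M.graph.Dart → ℚ} {l : List M.graph.Dart}
    (h : l.IsChain fun a b => leftSum w a.symm b = 0) : turnSum w l = 0 := by
  induction l with
  | nil => rfl
  | cons d l ih =>
    cases l with
    | nil => rfl
    | cons d' l =>
      rw [List.isChain_cons_cons] at h
      rw [turnSum, h.1, ih h.2, add_zero]

theorem leftFace_eq_of_net_eq_zero {h : M.Face → ℚ} {l : List M.graph.Dart}
    (hh : M.faceDiff h = net l) {b : M.graph.Dart} (hb : net l b = 0) :
    h (M.leftFace b.symm) = h (M.leftFace b) := by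
  have := congrFun hh b
  rw [faceDiff_apply, hb] at this
  linarith

theorem leftFace_cw_eq {h : M.Face → ℚ} {l : List M.graph.Dart}
    (hh : M.faceDiff h = net l) (b : M.graph.Dart) :
    h (M.leftFace (M.cw b)) = h (M.leftFace b) - net l b := by
  have := congrFun hh b
  rw [faceDiff_apply] at this
  rw [leftFace_cw]
  linarith

/-- The corners strictly to the left at a turn of a closed walk have the same winding number. -/
theorem leftFace_eq_of_turn {h : M.Face → ℚ} {l : List M.graph.Dart}
    (hh : M.faceDiff h = net l) (hl : IsRegular l) {a b : M.graph.Dart} (ha : a ∈ l) (hb : b ∈ l)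
    (hab : a.snd = b.fst) {k : ℕ} (hk : k < turn a.symm b) (hk' : k < turn a.symm a.symm) :
    h (M.leftFace ((M.cw ^ (k + 1)) a.symm)) = h (M.leftFace a) := by
  induction k with
  | zero =>
    rw [zero_add, pow_one, ← faceNext_apply, leftFace_faceNext]
  | succ k ih =>
    rw [cw_pow_succ, leftFace_cw_eq hh, ih (by omega) (by omega),
      hl.net_eq ha hb hab ((cw_pow_fst _ _).trans hab), if_neg, if_neg]
    · ring
    · intro heq
      have := turn_le (by omega) heq
      omega
    · intro heq
      have := turn_le (by omega) heq
      omega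

theorem leftFace_eq_of_consecutive {h : M.Face → ℚ} {l : List M.graph.Dart}
    (hh : M.faceDiff h = net l) (hl : IsRegular l) {a b : M.graph.Dart} (ha : a ∈ l) (hb : b ∈ l)
    (hab : a.snd = b.fst) : h (M.leftFace b) = h (M.leftFace a) := by
  have h1 := turn_spec (M := M) (a := a.symm) (b := b) hab
  have h2 := turn_le_turn_self (M := M) (a := a.symm) (b := b) hab
  have := leftFace_eq_of_turn hh hl ha hb hab (k := turn a.symm b - 1) (by omega) (by omega)
  rwa [Nat.sub_add_cancel h1.1, h1.2] at this

/-- With `h = 0` to the left of the cycle and `h = -1` to its right, `1 + h` selects exactly the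
darts strictly to the left at this vertex, together with `b`. -/
theorem leftSum_add_eq_of_turn {h : M.Face → ℚ} {l : List M.graph.Dart}
    (hh : M.faceDiff h = net l) (hl : IsRegular l) {a b : M.graph.Dart} (ha : a ∈ l) (hb : b ∈ l)
    (hab : a.snd = b.fst) (hne : a.symm ≠ b) (ha0 : h (M.leftFace a) = 0)
    (w : M.graph.Dart → ℚ) :
    leftSum w a.symm b + w b =
      ∑ c : M.graph.Dart with c.fst = b.fst, (1 + h (M.leftFace c)) * w c := by
  have hfst : a.symm.fst = b.fst := hab
  have h1 := turn_spec hfst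
  have h2 := turn_le_turn_self hfst
  have h3 := turn_spec (M := M) (a := a.symm) (b := a.symm) rfl
  have h4 : turn a.symm b ≠ turn a.symm a.symm := by
    intro heq
    rw [← heq, h1.2] at h3
    exact hne h3.2.symm
  rw [leftSum_add_last w hfst, ← hfst, ← sum_around,
    ← Finset.sum_Ico_consecutive _ (show 1 ≤ turn a.symm b + 1 by omega)
      (show turn a.symm b + 1 ≤ turn a.symm a.symm + 1 by omega)]
  have hsecond : ∀ k, turn a.symm b + k < turn a.symm a.symm →
      h (M.leftFace ((M.cw ^ (turn a.symm b + k + 1)) a.symm)) = -1 := by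
    intro k
    induction k with
    | zero =>
      intro _
      have := leftFace_eq_of_consecutive hh hl ha hb hab
      rw [add_zero, cw_pow_succ, h1.2, leftFace_cw_eq hh, hl.net_eq ha hb hab rfl, if_pos rfl,
        if_neg hne.symm, this, ha0]
      norm_num
    | succ k ih =>
      intro hk
      rw [← add_assoc] at hk ⊢
      rw [cw_pow_succ, leftFace_cw_eq hh, ih (by omega),
        hl.net_eq ha hb hab ((cw_pow_fst _ _).trans hab), if_neg, if_neg]
      · ring
      · intro heq
        have := turn_le (by omega) heq
        omega
      · intro heq
        have := cw_pow_inj rfl (by omega) h1.1 (by omega) h2 (heq.trans h1.2.symm)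
        omega
  rw [Finset.sum_eq_zero (s := Finset.Ico (turn a.symm b + 1) _), add_zero]
  · refine Finset.sum_congr rfl fun k hk => ?_
    rw [Finset.mem_Ico] at hk
    have := leftFace_eq_of_turn hh hl ha hb hab (k := k - 1) (by omega) (by omega)
    rw [Nat.sub_add_cancel hk.1] at this
    rw [this, ha0]
    ring
  · intro k hk
    rw [Finset.mem_Ico] at hk
    have := hsecond (k - turn a.symm b - 1) (by omega)
    rw [show turn a.symm b + (k - turn a.symm b - 1) + 1 = k by omega] at this
    rw [this]
    ring

theorem sum_leftFace_mul_off {h : M.Face → ℚ} {l : List M.graph.Dart}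
    (hh : M.faceDiff h = net l) {y : V} (hy : ∀ b ∈ l, b.fst ≠ y ∧ b.snd ≠ y)
    {b : M.graph.Dart} (hb : b.fst = y) (w : M.graph.Dart → ℚ) :
    ∑ c : M.graph.Dart with c.fst = y, (1 + h (M.leftFace c)) * w c =
      (1 + h (M.leftFace b)) * ∑ c : M.graph.Dart with c.fst = y, w c := by
  have hnet : ∀ c : M.graph.Dart, c.fst = y → net l c = 0 := fun c hc =>
    net_eq_zero (fun hm => (hy c hm).1 hc) (fun hm => (hy _ hm).2 hc)
  have hpow : ∀ k : ℕ, h (M.leftFace ((M.cw ^ k) b)) = h (M.leftFace b) := by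
    intro k
    induction k with
    | zero => rfl
    | succ k ih =>
      rw [cw_pow_succ, leftFace_cw_eq hh, ih, hnet _ ((cw_pow_fst _ _).trans hb), sub_zero]
  rw [Finset.mul_sum]
  refine Finset.sum_congr rfl fun c hc => ?_
  obtain ⟨k, rfl⟩ := exists_pow_cw_eq (hb.trans (Finset.mem_filter.1 hc).2.symm)
  rw [hpow]

/-- The flow from a vertex of a cycle with the root face on its left leaves the cycle to the left. -/
theorem sum_leftFace_mul_flow {A : V} {r : M.Face} (R : Reference M A r) {h : M.Face → ℚ}
    {l : List M.graph.Dart} (hh : M.faceDiff h = net l) (hl : IsRegular l)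
    (hfst : ∀ b ∈ l, ∃ b' ∈ l, b'.fst = b.snd) (hA : ∀ b ∈ l, b.fst ≠ A)
    {c : M.graph.Dart} (hc : c.fst = A) (hc0 : h (M.leftFace c) = 0)
    {x : V} (hx : ∃ b ∈ l, b.fst = x) :
    (l.map fun b => ∑ c : M.graph.Dart with c.fst = b.fst,
      (1 + h (M.leftFace c)) * R.flow x c).sum = (l.map (R.flow x)).sum + 1 := by
  set w := R.flow x with hw
  set G : V → ℚ := fun y => ∑ c : M.graph.Dart with c.fst = y, (1 + h (M.leftFace c)) * w c
  have h1 : (l.map fun b => G b.fst).sum = ∑ y ∈ (l.map fun d => d.fst).toFinset, G y := by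
    rw [List.sum_toFinset _ hl.1, List.map_map]
    rfl
  -- The constant part cancels by antisymmetry of the flow; the part with `h` is summation by parts
  -- against `faceDiff h = net l`.
  have h2 : ∑ y, G y = (l.map w).sum := by
    have e1 : ∑ d, w d = 0 := by
      have := sum_symm w
      simp only [hw, R.flow_antisymm x _, Finset.sum_neg_distrib] at this ⊢
      linarith
    have e2 := sum_mul_faceDiff (R.flow_antisymm x) h
    have e3 := sum_net_mul l (R.flow_antisymm x)
    rw [hh] at e2
    simp only [mul_comm (net l _)] at e3
    rw [Finset.sum_fiberwise Finset.univ (fun d : M.graph.Dart => d.fst)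
      (fun c => (1 + h (M.leftFace c)) * w c)]
    simp only [add_mul, one_mul, Finset.sum_add_distrib, e1]
    simp only [mul_comm (h _)]
    linarith
  have h3 : ∀ y ∉ (l.map fun d => d.fst).toFinset, G y = if y = A then -1 else 0 := by
    intro y hy
    simp only [List.mem_toFinset, List.mem_map, not_exists, not_and] at hy
    have hy' : ∀ b ∈ l, b.fst ≠ y ∧ b.snd ≠ y := by
      refine fun b hb => ⟨hy b hb, fun h => ?_⟩
      obtain ⟨b', hb', h'⟩ := hfst b hb
      exact hy b' hb' (h'.trans h)
    have hyx : y ≠ x := by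
      rintro rfl
      obtain ⟨b, hb, hbx⟩ := hx
      exact hy b hb hbx
    by_cases hyA : y = A
    · subst hyA
      change ∑ c : M.graph.Dart with c.fst = y, (1 + h (M.leftFace c)) * w c = _
      rw [sum_leftFace_mul_off hh hy' hc, R.flow_div, hc0]
      simp [hyx]
    · change ∑ c : M.graph.Dart with c.fst = y, (1 + h (M.leftFace c)) * w c = _
      rw [if_neg hyA]
      by_cases he : ∃ b : M.graph.Dart, b.fst = y
      · obtain ⟨b, hb⟩ := he
        rw [sum_leftFace_mul_off hh hy' hb, R.flow_div]
        simp [hyx, hyA]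
      · push Not at he
        rw [Finset.sum_eq_zero]
        intro c hc
        exact absurd (Finset.mem_filter.1 hc).2 (he c)
  have h4 : ∑ y ∈ (Finset.univ \ (l.map fun d => d.fst).toFinset), G y = -1 := by
    rw [Finset.sum_congr rfl fun y hy => h3 y (Finset.mem_sdiff.1 hy).2, Finset.sum_ite_eq',
      if_pos]
    simp only [Finset.mem_sdiff, Finset.mem_univ, List.mem_toFinset, List.mem_map, not_exists,
      not_and, true_and]
    exact hA
  have h5 := Finset.sum_sdiff (f := G) (Finset.subset_univ (l.map fun d => d.fst).toFinset)
  rw [h1]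
  linarith

theorem leftSum_outWeight_eq_zero {ξ : M.Corner} {O : Set M.graph.Dart}
    (hO : M.IsThreeOrientation ξ O) {d d' : M.graph.Dart} (hd : d ∈ O)
    (h : M.IsLeftmostTurn O d d') : leftSum (outWeight ξ O) d.symm d' = 0 := by
  obtain ⟨k, hk, hd', hlt⟩ := h
  have hk1 : 1 ≤ k := by
    by_contra h0
    obtain rfl : k = 0 := by omega
    rw [pow_zero, Equiv.Perm.one_apply] at hk
    exact hO.symm_notMem hd (hk ▸ hd')
  have hle := turn_le hk1 hk
  refine Finset.sum_eq_zero fun l hl => ?_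
  rw [Finset.mem_Ico] at hl
  have hb := hlt l (by omega)
  have h1 : (M.cw ^ l) d.symm ≠ ξ := fun heq => hb (heq ▸ hO.root_mem)
  have h2 : ((M.cw ^ l) d.symm).symm ≠ M.faceNext ξ := fun heq => hb <| by
    rw [← SimpleGraph.Dart.symm_symm ((M.cw ^ l) d.symm), heq]
    exact hO.faceNext_symm_mem
  -- The extra unit on `Bv` sits on a dart outside `O`, but the dart just before it clockwise is
  -- `BA`, which is outgoing: the leftmost turn would have stopped there.
  have h3 : (M.cw ^ l) d.symm ≠ M.faceNext (M.faceNext ξ) := fun heq => by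
    obtain ⟨j, rfl⟩ : ∃ j, l = j + 1 := ⟨l - 1, by omega⟩
    rw [cw_pow_succ, faceNext_apply] at heq
    refine hlt j (by omega) ?_
    rw [M.cw.injective heq]
    exact hO.faceNext_symm_mem
  rw [outWeight, if_neg hb, if_neg h1, if_neg h2, if_neg h3]
  norm_num

theorem exists_leftFace_eq_of_liesLeft {h : M.Face → ℚ} {x : V} {c : M.graph.Walk x x}
    (hh : M.faceDiff h = net c.darts) {f : M.Face} (hf : LiesLeft c f) :
    ∃ d ∈ c.darts, h (M.leftFace d) = h f := by
  obtain ⟨d, hd, hdf⟩ := hf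
  refine ⟨d, hd, ?_⟩
  induction hdf with
  | refl => rfl
  | tail _ hstep ih =>
    obtain ⟨b, hb, rfl, rfl⟩ := hstep
    have hmem : ∀ b' : M.graph.Dart, b'.edge = b.edge → b' ∉ c.darts := fun b' hbb' hm =>
      hb (hbb' ▸ List.mem_map.2 ⟨b', hm, rfl⟩)
    rw [ih, leftFace_eq_of_net_eq_zero hh (net_eq_zero (hmem b rfl) (hmem _ b.edge_symm))]

theorem snd_of_mem_getLast? {x y : V} (p : M.graph.Walk x y) :
    ∀ z ∈ p.darts.getLast?, z.snd = y := by
  induction p with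
  | nil => simp
  | @cons u v w h p ih =>
    intro z hz
    cases p with
    | nil =>
      simp only [SimpleGraph.Walk.darts_cons, SimpleGraph.Walk.darts_nil, List.getLast?_singleton,
        Option.mem_def, Option.some.injEq] at hz
      rw [← hz]
    | cons h' p =>
      rw [SimpleGraph.Walk.darts_cons, SimpleGraph.Walk.darts_cons, List.getLast?_cons_cons] at hz
      exact ih z hz

theorem snd_getLast_cons_darts {x y : V} {d : M.graph.Dart} (p : M.graph.Walk x y)
    (hd : d.snd = x) : ((d :: p.darts).getLast (List.cons_ne_nil _ _)).snd = y := by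
  subst hd
  exact snd_of_mem_getLast? (SimpleGraph.Walk.cons d.adj p) _ (List.getLast?_eq_some_getLast _)

theorem snd_ne_of_isPath {x y : V} {p : M.graph.Walk x y} (hp : p.IsPath) :
    ∀ b ∈ p.darts, b.snd ≠ x := by
  rintro b hb rfl
  have h := hp.support_nodup
  rw [← p.cons_map_snd_darts, List.nodup_cons] at h
  exact h.1 (List.mem_map.2 ⟨b, hb, rfl⟩)

theorem fst_ne_of_isPath {x y : V} {p : M.graph.Walk x y} (hp : p.IsPath) :
    ∀ b ∈ p.darts, b.fst ≠ y := by
  rintro b hb rfl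
  have h := hp.support_nodup
  rw [← p.map_fst_darts_append, List.nodup_append] at h
  exact h.2.2 _ (List.mem_map.2 ⟨b, hb, rfl⟩) _ (List.mem_singleton.2 rfl) rfl

theorem sum_sideWeight_nonpos (ξ : M.Corner) (l : List M.graph.Dart) :
    (l.map (sideWeight ξ)).sum ≤ 0 := by
  induction l with
  | nil => simp
  | cons d l ih =>
    rw [List.map_cons, List.sum_cons]
    linarith [sideWeight_nonpos ξ d]

/-! ### Leftmost walks: simplicity, existence, uniqueness -/

variable {ξ : M.Corner} {O : Set M.graph.Dart}

/-- In a minimal 3-orientation, a directed cycle has a turn which is not leftmost besides the one at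
any given vertex. -/
theorem not_isChain_isLeftmostTurn_of_isCycle (hM : M.IsTriangulation)
    (hO : M.IsThreeOrientation ξ O) (hmin : M.IsMinimal ξ O) (d : M.graph.Dart)
    (p : M.graph.Walk d.snd d.fst) (hp : p.IsPath) (hc : (SimpleGraph.Walk.cons d.adj p).IsCycle)
    (hdir : ∀ b ∈ d :: p.darts, b ∈ O) (hleft : (d :: p.darts).IsChain (M.IsLeftmostTurn O)) :
    False := by
  obtain ⟨R⟩ := nonempty_reference (M := M) (M.vertexA ξ) (M.cornerFace ξ)
  obtain ⟨f, hf⟩ := R.exists_isPotential (hO.sum_outWeight hM) (sum_sideWeight hM ξ)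
    (hO.outWeight_add_symm hM)
  set c := SimpleGraph.Walk.cons d.adj p with hcdef
  have hdarts : c.darts = d :: p.darts := rfl
  have hh : M.faceDiff (R.wind (d :: p.darts)) = net (d :: p.darts) := by
    rw [← hdarts, R.faceDiff_wind c, add_sub_cancel_right]
  set h := R.wind (d :: p.darts) with hhdef
  have hreg : IsRegular (d :: p.darts) := isRegular_of_isCycle hc
  have hr : h (M.cornerFace ξ) = 0 := R.wind_root _
  have hchain : (d :: (p.darts ++ [d])).IsChain
      fun a b => a.snd = b.fst ∧ a ∈ d :: p.darts ∧ b ∈ d :: p.darts := by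
    have h1 := (c.append d.adj.toWalk).isChain_dartAdj_darts
    have h2 : (c.append d.adj.toWalk).darts = d :: (p.darts ++ [d]) := by
      rw [SimpleGraph.Walk.darts_append]; rfl
    rw [h2] at h1
    refine h1.imp_of_mem_imp fun a b ha hb hab => ⟨hab, ?_, ?_⟩
    · rw [List.mem_cons, List.mem_append, List.mem_singleton] at ha
      rw [List.mem_cons]
      tauto
    · rw [List.mem_cons, List.mem_append, List.mem_singleton] at hb
      rw [List.mem_cons]
      tauto
  -- The winding function is constant along the left side of the cycle, and minimality connects that
  -- side to the root face without crossing the cycle.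
  have hleft0 : ∀ b ∈ d :: p.darts, h (M.leftFace b) = 0 := by
    have h1 : ∀ b ∈ d :: p.darts, h (M.leftFace b) = h (M.leftFace d) := by
      have h2 : (d :: p.darts).IsChain fun a b => h (M.leftFace b) = h (M.leftFace a) := by
        have h3 : (d :: p.darts) <+: (d :: (p.darts ++ [d])) := ⟨[d], rfl⟩
        exact (hchain.prefix h3).imp fun a b hab =>
          leftFace_eq_of_consecutive hh hreg hab.2.1 hab.2.2 hab.1
      exact h2.induction (fun b => h (M.leftFace b) = h (M.leftFace d)) _
        (fun a b hab ha => hab.trans ha) fun _ => rfl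
    obtain ⟨b, hb, hbr⟩ := exists_leftFace_eq_of_liesLeft (c := c) hh (hmin _ c hc hdir)
    intro b' hb'
    rw [h1 b' hb', ← h1 b hb, hbr, hr]
  set w := R.flow d.fst with hw
  set z := (d :: p.darts).getLast (List.cons_ne_nil _ _) with hz
  have hzmem : z ∈ d :: p.darts := List.getLast_mem _
  have hzx : z.snd = d.fst := snd_getLast_cons_darts p rfl
  have hflux : turnSum w (d :: p.darts) + leftSum w z.symm d = 1 := by
    have h1 := turnSum_add_sum (w := w)
      (G := fun b => ∑ c : M.graph.Dart with c.fst = b.fst, (1 + h (M.leftFace c)) * w c)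
      d (p.darts ++ [d]) (hchain.imp fun a b hab => by
        refine leftSum_add_eq_of_turn hh hreg hab.2.1 hab.2.2 hab.1 ?_ (hleft0 a hab.2.1) w
        rintro rfl
        exact hO.symm_notMem (hdir _ hab.2.1) (hdir _ hab.2.2))
    have h2 := sum_leftFace_mul_flow R hh hreg (fun b hb => ?_)
      (fun b hb hbA => hO.notMem_of_fst_eq hbA (hdir b hb)) (c := M.faceNext ξ) (faceNext_fst ξ)
      (by rw [leftFace_faceNext]; exact hr) ⟨d, List.mem_cons_self, rfl⟩
    · rw [turnSum_concat] at h1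
      simp only [List.map_append, List.sum_append, List.map_cons, List.map_nil, List.sum_cons,
        List.sum_nil, add_zero] at h1 h2
      linarith
    · have hs : b.snd ∈ c.support.tail := by
        rw [← c.map_snd_darts]
        exact List.mem_map.2 ⟨b, hb, rfl⟩
      have hs' := c.tail_support_perm_dropLast_support.mem_iff.1 hs
      rw [← c.map_fst_darts] at hs'
      obtain ⟨b', hb', h4⟩ := List.mem_map.1 hs'
      exact ⟨b', hb', h4⟩
  have hturn : turnSum (outWeight ξ O) (d :: p.darts) = 0 := by
    refine turnSum_eq_zero (hleft.imp_of_mem_imp fun a b ha _ hab => ?_)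
    exact leftSum_outWeight_eq_zero hO (hdir a ha) hab
  have hid := R.potential_sub_eq hf d p.darts (isSimpleChain_cons_darts p hp rfl)
  rw [← hz, hzx, ← hhdef, hleft0 d List.mem_cons_self, hturn] at hid
  have hlast := leftSum_telescope f (a := z.symm) (b := d) hzx
  have hlast' : leftSum (fun b => f (M.cw b) - f b) z.symm d =
      leftSum (outWeight ξ O - (3 : ℚ) • w) z.symm d := by
    refine leftSum_congr hzx fun b hb _ => ?_
    rw [hf.cw b, hb]
    rfl
  rw [hlast', leftSum_sub, leftSum_smul, ← faceNext_apply] at hlast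
  -- By `hid`, `hlast` and `hflux`, the weight left of the closing turn is 3 minus this sum, so at
  -- least 3; with `d` itself it exceeds the total 3 at the vertex.
  have hσ : ((d :: p.darts).map (sideWeight ξ)).sum ≤ 0 := sum_sideWeight_nonpos ξ _
  have hdO := hdir d List.mem_cons_self
  have hle := leftSum_add_le (outWeight_nonneg ξ O) (a := z.symm) (b := d) hzx
  rw [hO.sum_outWeight hM, if_neg fun hA => hO.notMem_of_fst_eq hA hdO] at hle
  have := one_le_outWeight ξ hdO
  linarith

/-- A return to the first vertex would close a directed cycle on the path that follows. Nothing is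
known of its closing turn, which is why the cycle lemma spares one turn. -/
theorem isPath_of_isChain_isLeftmostTurn (hM : M.IsTriangulation)
    (hO : M.IsThreeOrientation ξ O) (hmin : M.IsMinimal ξ O) {x y : V} (p : M.graph.Walk x y)
    (hdir : ∀ b ∈ p.darts, b ∈ O) (hleft : p.darts.IsChain (M.IsLeftmostTurn O)) : p.IsPath := by
  induction p with
  | nil => exact SimpleGraph.Walk.IsPath.nil
  | @cons u v w h p ih =>
    rw [SimpleGraph.Walk.darts_cons] at hdir hleft
    have hp := ih (fun b hb => hdir b (List.mem_cons_of_mem _ hb)) hleft.tail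
    rw [SimpleGraph.Walk.cons_isPath_iff]
    refine ⟨hp, fun hu => ?_⟩
    have hpre : (p.takeUntil u hu).darts <+: p.darts := by
      refine ⟨(p.dropUntil u hu).darts, ?_⟩
      rw [← SimpleGraph.Walk.darts_append, SimpleGraph.Walk.take_spec]
    have hq := hp.takeUntil hu
    set q := p.takeUntil u hu
    have hdir' : ∀ b ∈ (⟨(u, v), h⟩ : M.graph.Dart) :: q.darts, b ∈ O := fun b hb =>
      hdir b (List.IsPrefix.subset (List.cons_prefix_cons.2 ⟨rfl, hpre⟩) hb)
    refine not_isChain_isLeftmostTurn_of_isCycle hM hO hmin ⟨(u, v), h⟩ q hq ?_ hdir'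
      (hleft.prefix (List.cons_prefix_cons.2 ⟨rfl, hpre⟩))
    rw [SimpleGraph.Walk.cons_isCycle_iff]
    refine ⟨hq, fun he => ?_⟩
    obtain ⟨b, hb, hbe⟩ := List.mem_map.1 he
    rcases (SimpleGraph.dart_edge_eq_iff b ⟨(u, v), h⟩).1 hbe with rfl | rfl
    · exact snd_ne_of_isPath hq _ hb rfl
    · exact hO.symm_notMem (hdir' _ List.mem_cons_self) (hdir' _ (List.mem_cons_of_mem _ hb))

theorem IsLeftmostTurn.fst_eq {d d' : M.graph.Dart} (h : M.IsLeftmostTurn O d d') :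
    d'.fst = d.snd := by
  obtain ⟨k, rfl, -⟩ := h
  exact cw_pow_fst _ _

theorem IsLeftmostTurn.mem {d d' : M.graph.Dart} (h : M.IsLeftmostTurn O d d') : d' ∈ O := by
  obtain ⟨k, -, h, -⟩ := h
  exact h

theorem IsLeftmostTurn.unique {d d₁ d₂ : M.graph.Dart} (h₁ : M.IsLeftmostTurn O d d₁)
    (h₂ : M.IsLeftmostTurn O d d₂) : d₁ = d₂ := by
  obtain ⟨k₁, e₁, m₁, l₁⟩ := h₁
  obtain ⟨k₂, e₂, m₂, l₂⟩ := h₂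
  rcases lt_trichotomy k₁ k₂ with h | h | h
  · exact absurd (e₁ ▸ m₁) (l₂ k₁ h)
  · rw [← e₁, ← e₂, h]
  · exact absurd (e₂ ▸ m₂) (l₁ k₂ h)

theorem IsThreeOrientation.exists_isLeftmostTurn (hO : M.IsThreeOrientation ξ O)
    {d : M.graph.Dart} (hd : d.snd ≠ M.vertexA ξ) : ∃ d', M.IsLeftmostTurn O d d' := by
  have hdeg : M.outdeg O d.snd ≠ 0 := by
    by_cases hB : d.snd = M.vertexB ξ
    · rw [hB, hO.outdeg_B]; norm_num
    · by_cases hv : d.snd = M.cornerVertex ξ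
      · rw [hv, hO.outdeg_v]; norm_num
      · rw [hO.outdeg_inner _ hd hB hv]; norm_num
  obtain ⟨⟨b, hbO, hb⟩⟩ := (Nat.card_ne_zero.1 hdeg).1
  obtain ⟨k, hk⟩ := exists_pow_cw_eq (M := M) (a := d.symm) (b := b) hb.symm
  classical
  have hex : ∃ k, (M.cw ^ k) d.symm ∈ O := ⟨k, hk ▸ hbO⟩
  exact ⟨_, Nat.find hex, rfl, Nat.find_spec hex, fun j hj => Nat.find_min hex hj⟩

/-- Only `A` has no outgoing edge, so a leftmost walk that never reaches `A` can be prolonged beyond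
the number of vertices, contradicting simplicity. -/
theorem exists_isLeftmostPath (hM : M.IsTriangulation)
    (hO : M.IsThreeOrientation ξ O) (hmin : M.IsMinimal ξ O) {e : M.graph.Dart} (he : e ∈ O) :
    ∃ P : M.graph.Walk e.fst (M.vertexA ξ), IsLeftmostPath O e P := by
  by_contra hno
  have key : ∀ n : ℕ, ∃ (a : V) (P : M.graph.Walk e.fst a), IsLeftmostPath O e P ∧
      P.length = n + 1 := by
    intro n
    induction n with
    | zero =>
      refine ⟨e.snd, e.adj.toWalk, ⟨rfl, ?_, ?_⟩, rfl⟩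
      · intro d hd
        have : d = e := by simpa using hd
        rwa [this]
      · exact List.IsChain.singleton _
    | succ n ih =>
      obtain ⟨a, P, hP, hn⟩ := ih
      have ha : a ≠ M.vertexA ξ := by
        rintro rfl
        exact hno ⟨P, hP⟩
      have hne : P.darts ≠ [] := by
        intro h
        have := P.length_darts
        rw [h, List.length_nil] at this
        omega
      have hz := snd_of_mem_getLast? P _ (List.getLast?_eq_some_getLast hne)
      obtain ⟨d', hd'⟩ := hO.exists_isLeftmostTurn (d := P.darts.getLast hne) (hz.symm ▸ ha)
      have hfst := hd'.fst_eq.trans hz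
      subst hfst
      have hdarts : (P.append d'.adj.toWalk).darts = P.darts ++ [d'] := by
        rw [SimpleGraph.Walk.darts_append]; rfl
      refine ⟨d'.snd, P.append d'.adj.toWalk, ⟨?_, ?_, ?_⟩, ?_⟩
      · rw [hdarts, List.head?_append, hP.starts]; rfl
      · rw [hdarts]
        intro d hd
        rcases List.mem_append.1 hd with hd | hd
        · exact hP.directed d hd
        · rw [List.mem_singleton.1 hd]; exact hd'.mem
      · rw [hdarts]
        refine hP.leftmost.append (List.IsChain.singleton _) ?_
        intro x hx y hy
        rw [List.getLast?_eq_some_getLast hne, Option.mem_def, Option.some.injEq] at hx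
        rw [List.head?_cons, Option.mem_def, Option.some.injEq] at hy
        rwa [← hx, ← hy]
      · rw [SimpleGraph.Walk.length_append, hn]; rfl
  obtain ⟨a, P, hP, hn⟩ := key (Fintype.card V)
  have := (isPath_of_isChain_isLeftmostTurn hM hO hmin P hP.directed hP.leftmost).length_lt
  omega

theorem eq_of_isChain_isLeftmostTurn (hO : M.IsThreeOrientation ξ O) (d : M.graph.Dart)
    (l₁ l₂ : List M.graph.Dart) (h₁ : (d :: l₁).IsChain (M.IsLeftmostTurn O))
    (h₂ : (d :: l₂).IsChain (M.IsLeftmostTurn O))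
    (e₁ : ∀ z ∈ (d :: l₁).getLast?, z.snd = M.vertexA ξ)
    (e₂ : ∀ z ∈ (d :: l₂).getLast?, z.snd = M.vertexA ξ) : l₁ = l₂ := by
  induction l₁ generalizing d l₂ with
  | nil =>
    cases l₂ with
    | nil => rfl
    | cons d₂ l₂ =>
      have hd := e₁ d rfl
      have ht := (List.isChain_cons_cons.1 h₂).1
      exact absurd ht.mem (hO.notMem_of_fst_eq (ht.fst_eq.trans hd))
  | cons d₁ l₁ ih =>
    have ht := (List.isChain_cons_cons.1 h₁).1
    cases l₂ with
    | nil =>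
      have hd := e₂ d rfl
      exact absurd ht.mem (hO.notMem_of_fst_eq (ht.fst_eq.trans hd))
    | cons d₂ l₂ =>
      obtain rfl := ht.unique (List.isChain_cons_cons.1 h₂).1
      rw [List.getLast?_cons_cons] at e₁ e₂
      rw [ih d₁ l₂ (List.isChain_cons_cons.1 h₁).2 (List.isChain_cons_cons.1 h₂).2 e₁ e₂]

theorem IsLeftmostPath.darts_eq {e : M.graph.Dart} {a : V} {P : M.graph.Walk e.fst a}
    (hP : IsLeftmostPath O e P) : P.darts = e :: P.darts.tail :=
  (List.cons_head?_tail hP.starts).symm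

theorem existsUnique_isLeftmostPath (hM : M.IsTriangulation)
    (hO : M.IsThreeOrientation ξ O) (hmin : M.IsMinimal ξ O) {e : M.graph.Dart} (he : e ∈ O) :
    ∃! P : M.graph.Walk e.fst (M.vertexA ξ), IsLeftmostPath O e P := by
  obtain ⟨P, hP⟩ := exists_isLeftmostPath hM hO hmin he
  refine ⟨P, hP, fun P' hP' => ?_⟩
  apply SimpleGraph.Walk.darts_injective
  have h1 := snd_of_mem_getLast? P
  have h2 := snd_of_mem_getLast? P'
  have h3 := hP.leftmost
  have h4 := hP'.leftmost
  rw [hP.darts_eq] at h1 h3 ⊢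
  rw [hP'.darts_eq] at h2 h4 ⊢
  rw [eq_of_isChain_isLeftmostTurn hO e _ _ h3 h4 h1 h2]

/-! ### Integer winding numbers -/

theorem net_reverse {x y : V} (p : M.graph.Walk x y) : net p.reverse.darts = -net p.darts := by
  have hcount : ∀ d : M.graph.Dart, p.reverse.darts.count d = p.darts.count d.symm := by
    intro d
    rw [SimpleGraph.Walk.darts_reverse, List.count_reverse]
    conv_lhs => rw [← d.symm_symm]
    exact List.count_map_of_injective _ _ SimpleGraph.Dart.symm_involutive.injective _
  ext d
  rw [net, hcount, hcount, d.symm_symm, Pi.neg_apply, net]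
  ring

theorem IsWinding.faceDiff_eq {r : M.Face} {x : V} {C : M.graph.Walk x x} {h : M.Face → ℤ}
    (hh : IsWinding r C h) : M.faceDiff (fun f => (h f : ℚ)) = net C.darts := by
  ext d
  rw [faceDiff_apply, net]
  exact_mod_cast hh.2 d

/-- A closed walk is divergence-free, which gives a rational solution; it is integral because it is
0 at `r` and jumps by integers across edges. -/
theorem existsUnique_isWinding (r : M.Face) {x : V} (C : M.graph.Walk x x) :
    ∃! h : M.Face → ℤ, IsWinding r C h := by
  obtain ⟨g, hg, hgr⟩ := exists_faceDiff_eq_of_root (net_mem_antisymm C.darts)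
    (fun z => by rw [sum_net_walk, sub_self]) r
  have hint : ∀ f, ∃ n : ℤ, g f = n := by
    refine forall_face_of_adj (fun f => ∃ n : ℤ, g f = n) (fun d hd => ?_)
      (f₀ := r) ⟨0, by simp [hgr]⟩
    obtain ⟨n, hn⟩ := hd
    have := congrFun hg d
    rw [faceDiff_apply, net] at this
    refine ⟨n - (C.darts.count d - C.darts.count d.symm), ?_⟩
    push_cast
    linarith
  choose h hh using hint
  refine ⟨h, ⟨?_, fun d => ?_⟩, fun h' hh' => ?_⟩
  · have := hh r
    rw [hgr] at this
    exact_mod_cast this.symm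
  · have := congrFun hg d
    rw [faceDiff_apply, net, hh, hh] at this
    exact_mod_cast this
  · have := eq_of_faceDiff_eq (hh'.faceDiff_eq.trans hg.symm) (r := r) (by simp [hh'.1, hgr])
    funext f
    have h1 := congrFun this f
    rw [hh f] at h1
    exact_mod_cast h1

/-! ### How `Q` turns at the vertices of `P` -/

/-- The part of `turnSum` contributed by the turns at `y`. -/
noncomputable def turnSumAt (w : M.graph.Dart → ℚ) (y : V) : List M.graph.Dart → ℚ
  | [] => 0
  | [_] => 0
  | d :: d' :: l => (if d'.fst = y then leftSum w d.symm d' else 0) + turnSumAt w y (d' :: l)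

theorem turnSumAt_nonneg {w : M.graph.Dart → ℚ} (hw : ∀ d, 0 ≤ w d) (y : V)
    (l : List M.graph.Dart) : 0 ≤ turnSumAt w y l := by
  induction l with
  | nil => exact le_rfl
  | cons d l ih =>
    cases l with
    | nil => exact le_rfl
    | cons d' l =>
      rw [turnSumAt]
      have := leftSum_nonneg hw d.symm d'
      positivity

theorem sum_turnSumAt (w : M.graph.Dart → ℚ) (l : List M.graph.Dart) :
    ∑ y, turnSumAt w y l = turnSum w l := by
  induction l with
  | nil => simp [turnSumAt, turnSum]
  | cons d l ih =>
    cases l with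
    | nil => simp [turnSumAt, turnSum]
    | cons d' l =>
      simp only [turnSumAt, turnSum, Finset.sum_add_distrib, ih, Finset.sum_ite_eq,
        Finset.mem_univ, if_true]

theorem turnSum_nonneg {w : M.graph.Dart → ℚ} (hw : ∀ d, 0 ≤ w d) (l : List M.graph.Dart) :
    0 ≤ turnSum w l := by
  rw [← sum_turnSumAt]
  exact Finset.sum_nonneg fun y _ => turnSumAt_nonneg hw y l

theorem leftSum_le_turnSumAt {w : M.graph.Dart → ℚ} (hw : ∀ d, 0 ≤ w d)
    {l : List M.graph.Dart} {a b : M.graph.Dart} (h : [a, b] <:+: l) :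
    leftSum w a.symm b ≤ turnSumAt w b.fst l := by
  induction l with
  | nil => simp at h
  | cons d l ih =>
    cases l with
    | nil =>
      have := h.length_le
      simp at this
    | cons d' l =>
      rw [turnSumAt]
      have h1 := turnSumAt_nonneg hw b.fst (d' :: l)
      rcases List.infix_cons_iff.1 h with h | h
      · rw [List.cons_prefix_cons, List.cons_prefix_cons] at h
        obtain ⟨rfl, rfl, -⟩ := h
        rw [if_pos rfl]
        linarith
      · have h2 := ih h
        have := leftSum_nonneg hw d.symm d'
        split_ifs <;> linarith

theorem exists_infix_of_mem {x y z : V} (p : M.graph.Walk x y) (hx : z ≠ x) (hy : z ≠ y)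
    (h : (∃ b ∈ p.darts, b.fst = z) ∨ ∃ b ∈ p.darts, b.snd = z) :
    ∃ a b, [a, b] <:+: p.darts ∧ a.snd = z ∧ b.fst = z := by
  induction p with
  | nil => simp at h
  | @cons u v w hadj p ih =>
    rw [SimpleGraph.Walk.darts_cons] at h ⊢
    by_cases hzv : z = v
    · subst hzv
      cases p with
      | nil => exact absurd rfl hy
      | @cons _ v' _ h' p =>
        refine ⟨_, ⟨(z, v'), h'⟩, ⟨[], p.darts, rfl⟩, rfl, rfl⟩
    · have h' : (∃ b ∈ p.darts, b.fst = z) ∨ ∃ b ∈ p.darts, b.snd = z := by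
        rcases h with ⟨b, hb, hbz⟩ | ⟨b, hb, hbz⟩
        · rcases List.mem_cons.1 hb with rfl | hb
          · exact absurd hbz.symm hx
          · exact .inl ⟨b, hb, hbz⟩
        · rcases List.mem_cons.1 hb with rfl | hb
          · exact absurd hbz.symm hzv
          · exact .inr ⟨b, hb, hbz⟩
      obtain ⟨a, b, hab, ha, hb⟩ := ih hzv hy h'
      exact ⟨a, b, hab.trans (List.suffix_cons _ _).isInfix, ha, hb⟩

theorem sub_le_sum_of_isChain {H : M.graph.Dart → ℚ} {T : V → ℚ} (d : M.graph.Dart)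
    (l : List M.graph.Dart) (h : (d :: l).IsChain fun a b => H b - H a ≤ T b.fst) :
    H ((d :: l).getLast (List.cons_ne_nil _ _)) - H d ≤ (l.map fun b => T b.fst).sum := by
  induction l generalizing d with
  | nil => simp
  | cons d' l ih =>
    rw [List.isChain_cons_cons] at h
    have := ih d' h.2
    rw [List.getLast_cons_cons, List.map_cons, List.sum_cons]
    linarith [h.1]

theorem net_eq_neg_of_fst_eq {x y : V} {Q : M.graph.Walk x y} (hQ : Q.IsPath)
    {q : M.graph.Dart} (hq : q ∈ Q.darts) (hqy : q.snd = y) {b : M.graph.Dart} (hb : b.fst = y) :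
    net Q.darts b = -if b = q.symm then 1 else 0 := by
  have hreg := isRegular_of_isPath hQ
  have h1 : b ∉ Q.darts := fun h => fst_ne_of_isPath hQ b h hb
  have h2 : b.symm ∈ Q.darts ↔ b = q.symm := by
    constructor
    · intro h
      rw [← hreg.snd_inj (a := b.symm) h hq (hb.trans hqy.symm), b.symm_symm]
    · rintro rfl
      rwa [q.symm_symm]
  rw [net, hreg.count_eq, hreg.count_eq, if_neg h1]
  simp only [h2]
  push_cast
  ring

theorem net_eq_of_fst_eq {x y : V} {Q : M.graph.Walk x y} (hQ : Q.IsPath)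
    {q : M.graph.Dart} (hq : q ∈ Q.darts) (hqx : q.fst = x) {b : M.graph.Dart} (hb : b.fst = x) :
    net Q.darts b = if b = q then 1 else 0 := by
  have hreg := isRegular_of_isPath hQ
  have h1 : b.symm ∉ Q.darts := fun h => snd_ne_of_isPath hQ _ h hb
  have h2 : b ∈ Q.darts ↔ b = q :=
    ⟨fun h => hreg.fst_inj h hq (hb.trans hqx.symm), fun h => h ▸ hq⟩
  rw [net, hreg.count_eq, hreg.count_eq, if_neg h1]
  simp only [h2]
  push_cast
  ring

theorem leftSum_leftFace {h : M.Face → ℚ} {n : M.graph.Dart → ℚ} (hh : M.faceDiff h = n)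
    {a b : M.graph.Dart} (hab : a.fst = b.fst) :
    leftSum n a b = h (M.leftFace (M.cw a)) - h (M.leftFace b) := by
  have h1 := leftSum_telescope (fun d => h (M.leftFace d)) hab
  have h2 : (fun d => h (M.leftFace (M.cw d)) - h (M.leftFace d)) = (-1 : ℚ) • n := by
    ext d
    have := congrFun hh d
    rw [faceDiff_apply] at this
    rw [leftFace_cw, Pi.smul_apply, ← this, smul_eq_mul]
    ring
  rw [h2, leftSum_smul] at h1
  linarith

/-- The winding number on the right of a path `P`, lowered by one where `Q` runs along `P` backwards,
increases at a turn of `P` only if `Q` leaves `P` on its left there. -/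
theorem right_sub_right_le {x y : V} {P Q : M.graph.Walk x y} (hP : P.IsPath)
    (hQ : Q.IsPath) {h : M.Face → ℚ} (hh : M.faceDiff h = net Q.darts - net P.darts)
    {o : M.graph.Dart → ℚ} (ho : ∀ d, 0 ≤ o d) {p p' : M.graph.Dart} (hp : p ∈ P.darts)
    (hp' : p' ∈ P.darts) (hpp' : p.snd = p'.fst) (hop : 1 ≤ o p') :
    (h (M.leftFace p'.symm) - if p'.symm ∈ Q.darts then 1 else 0) -
      (h (M.leftFace p.symm) - if p.symm ∈ Q.darts then 1 else 0) ≤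
    turnSumAt o p'.fst Q.darts := by
  have hregP := isRegular_of_isPath hP
  have hregQ := isRegular_of_isPath hQ
  have hfst : p'.fst = p.symm.fst := hpp'.symm
  have h1 : leftSum (net Q.darts) p' p.symm =
      h (M.leftFace p'.symm) - h (M.leftFace p.symm) := by
    rw [← leftFace_cw, ← leftSum_leftFace hh hfst]
    refine leftSum_congr_of_ne hfst fun d hd hdp' hdp => ?_
    rw [Pi.sub_apply, hregP.net_eq hp hp' hpp' (hd.trans hfst.symm), if_neg hdp', if_neg hdp]
    ring
  by_cases hex : (∃ b ∈ Q.darts, b.fst = p'.fst) ∨ ∃ b ∈ Q.darts, b.snd = p'.fst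
  · obtain ⟨a, b, hab, ha, hb⟩ := exists_infix_of_mem Q
      (fun h => snd_ne_of_isPath hP p hp (hpp'.trans h)) (fst_ne_of_isPath hP p' hp') hex
    have haQ : a ∈ Q.darts := hab.subset (by simp)
    have hbQ : b ∈ Q.darts := hab.subset (by simp)
    have hab' : a.symm.fst = b.fst := ha.trans hb.symm
    have hpa : p'.fst = a.symm.fst := ha.symm
    have h2 := leftSum_le_turnSumAt ho hab
    rw [hb] at h2
    have h3 : leftSum (net Q.darts) p' p.symm =
        (if turn p' b < turn p' p.symm then 1 else 0) -
          (if turn p' a.symm < turn p' p.symm then 1 else 0) := by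
      rw [← leftSum_ite_eq hfst hb.symm, ← leftSum_ite_eq hfst hpa, ← leftSum_sub]
      refine leftSum_congr hfst fun d hd _ => ?_
      rw [hregQ.net_eq haQ hbQ hab' ((hd.trans hfst.symm).trans hb.symm)]
      rfl
    have s1 := turn_spec hfst
    have s2 := turn_spec (M := M) (a := p') (b := p') rfl
    have s3 := turn_spec hb.symm
    have s4 := turn_spec hpa
    have s5 := turn_spec hab'
    have t1 := turn_le_turn_self hfst
    have t2 := turn_le_turn_self hb.symm
    have t3 := turn_le_turn_self hpa
    have h4 : p'.symm ∈ Q.darts ↔ turn p' a.symm = turn p' p' := by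
      constructor
      · intro hm
        have := hregQ.snd_inj hm haQ ha.symm
        rw [← this, p'.symm_symm]
      · intro heq
        rw [← s2.2, ← heq, s4.2, a.symm_symm]
        exact haQ
    have h5 : p.symm ∈ Q.darts ↔ turn p' b = turn p' p.symm := by
      constructor
      · intro hm
        rw [hregQ.fst_inj hm hbQ (hfst.symm.trans hb.symm)]
      · intro heq
        rw [← s1.2, ← heq, s3.2]
        exact hbQ
    have h6 : 0 ≤ leftSum o a.symm b := leftSum_nonneg ho _ _
    simp only [h4, h5]
    rw [h1] at h3
    -- Clockwise order `p'`, `b`, `p.symm`, `a.symm`, with coincidences allowed: `Q` leaves into the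
    -- right side of `P` without having arrived from its interior or along `p'`. Only here can the
    -- left-hand side be positive, and then `p'` lies strictly to the left of `Q` and pays for it.
    by_cases hcase : turn p' b ≤ turn p' p.symm ∧ turn p' p.symm ≤ turn p' a.symm ∧
        turn p' a.symm < turn p' p'
    · obtain ⟨c1, c2, c3⟩ := hcase
      have hN : (M.cw ^ (turn p' p' - turn p' a.symm)) a.symm = p' := by
        have := cw_pow_add (turn p' p' - turn p' a.symm) (turn p' a.symm) p'
        rwa [Nat.sub_add_cancel c3.le, s2.2, s4.2, eq_comm] at this
      have hlt : turn p' p' - turn p' a.symm < turn a.symm b := by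
        by_contra hge
        have h7 : (M.cw ^ (turn a.symm b + turn p' a.symm)) p' = (M.cw ^ turn p' b) p' := by
          rw [cw_pow_add, s4.2, s5.2, s3.2]
        have := cw_pow_inj rfl (by omega) s3.1 (by omega) t2 h7
        omega
      have h8 := le_leftSum ho (by omega) hlt
      rw [hN] at h8
      rw [if_neg (by omega : ¬ turn p' a.symm = turn p' p')]
      rw [if_neg (by omega : ¬ turn p' a.symm < turn p' p.symm)] at h3
      by_cases c4 : turn p' b = turn p' p.symm
      · rw [if_pos c4]
        rw [if_neg (by omega)] at h3
        linarith
      · rw [if_neg c4]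
        rw [if_pos (by omega)] at h3
        linarith
    · split_ifs at h3 ⊢ <;> first | linarith | omega
  · push Not at hex
    have e1 : p'.symm ∉ Q.darts := fun hm => hex.2 _ hm rfl
    have e2 : p.symm ∉ Q.darts := fun hm => hex.1 _ hm hpp'
    have e3 : leftSum (net Q.darts) p' p.symm = leftSum 0 p' p.symm := by
      refine leftSum_congr hfst fun d hd _ => ?_
      exact net_eq_zero (fun hm => hex.1 d hm (hd.trans hfst.symm))
        (fun hm => hex.2 _ hm (hd.trans hfst.symm))
    rw [leftSum_zero, h1] at e3
    rw [if_neg e1, if_neg e2]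
    linarith [turnSumAt_nonneg ho p'.fst Q.darts]

/-- Rotating at the endpoint from the left of `p` to a corner of value 0 crosses at most the last
edge of `Q`, so the left of `p` has value at least -1. Crossing `p` to its right adds 1, unless `p`
is also the last edge of `Q`. -/
theorem right_last_nonneg {x y : V} {P Q : M.graph.Walk x y} (hP : P.IsPath)
    (hQ : Q.IsPath) {h : M.Face → ℚ} (hh : M.faceDiff h = net Q.darts - net P.darts)
    {p q : M.graph.Dart} (hp : p ∈ P.darts) (hpy : p.snd = y) (hq : q ∈ Q.darts)
    (hqy : q.snd = y) {c : M.graph.Dart} (hc : c.fst = y) (hc0 : h (M.leftFace c) = 0) :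
    0 ≤ h (M.leftFace p.symm) := by
  have hpc : p.symm.fst = c.fst := hpy.trans hc.symm
  have hpq : p.symm.fst = q.symm.fst := hpy.trans hqy.symm
  have h1 := leftSum_leftFace hh hpc
  have h2 : leftSum (net Q.darts - net P.darts) p.symm c =
      -if turn p.symm q.symm < turn p.symm c then 1 else 0 := by
    rw [← leftSum_ite_eq hpc hpq, ← neg_one_mul, ← leftSum_smul]
    refine leftSum_congr_of_ne hpc fun d hd hdp _ => ?_
    rw [Pi.sub_apply, net_eq_neg_of_fst_eq hQ hq hqy (hd.trans hc),
      net_eq_neg_of_fst_eq hP hp hpy (hd.trans hc), if_neg hdp, Pi.smul_apply, smul_eq_mul]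
    ring
  have h3 := congrFun hh p.symm
  rw [faceDiff_apply, Pi.sub_apply, net_eq_neg_of_fst_eq hQ hq hqy hpy,
    net_eq_neg_of_fst_eq hP hp hpy hpy, if_pos rfl, ← leftFace_cw p.symm] at h3
  have h4 := turn_le_turn_self hpc
  by_cases hqp : p.symm = q.symm
  · rw [if_pos hqp] at h3
    rw [← hqp, if_neg (by omega)] at h2
    linarith
  · rw [if_neg hqp] at h3
    split_ifs at h2 <;> linarith

/-! ### Comparison of `Q` with the leftmost path -/

theorem exists_darts_eq_cons {x y : V} (p : M.graph.Walk x y) (h : x ≠ y) :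
    ∃ d l, p.darts = d :: l ∧ d.fst = x := by
  cases p with
  | nil => exact absurd rfl h
  | cons hadj p => exact ⟨_, _, rfl, rfl⟩

theorem isSimpleChain_darts {x y : V} {p : M.graph.Walk x y} (hp : p.IsPath) :
    IsSimpleChain p.darts := by
  cases p with
  | nil => trivial
  | cons hadj p => exact isSimpleChain_cons_darts p hp.of_cons rfl

theorem neg_length_le_sum_sideWeight (ξ : M.Corner) (l : List M.graph.Dart) :
    -(l.length : ℚ) ≤ (l.map (sideWeight ξ)).sum := by
  induction l with
  | nil => simp
  | cons d l ih =>
    rw [List.map_cons, List.sum_cons, List.length_cons]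
    push_cast
    linarith [neg_one_le_sideWeight ξ d]

/-- Of the three darts with the root face on their left, `AB` and `Bv` are not outgoing: `A` has
outdegree 0, and the only edge out of `B` goes to `A`. -/
theorem IsThreeOrientation.sideWeight_eq (hM : M.IsTriangulation)
    (hO : M.IsThreeOrientation ξ O) {d : M.graph.Dart} (hd : d ∈ O) :
    sideWeight ξ d = -1 + if d = ξ then 1 else 0 := by
  have : M.leftFace d = M.cornerFace ξ ↔ d = ξ := by
    refine (leftFace_eq_iff_of_isTriangulation hM).trans ⟨?_, Or.inl⟩
    rintro (h | rfl | rfl)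
    · exact h
    · exact absurd hd hO.faceNext_notMem
    · exact absurd hd (IsThreeOrientation.faceNext_faceNext_notMem hM hO)
  rw [sideWeight]
  simp only [this]

theorem IsThreeOrientation.sum_sideWeight_le (hM : M.IsTriangulation)
    (hO : M.IsThreeOrientation ξ O) (l : List M.graph.Dart) (hl : ∀ d ∈ l, d ∈ O) :
    (l.map (sideWeight ξ)).sum ≤ -(l.length : ℚ) + l.count ξ := by
  induction l with
  | nil => simp
  | cons d l ih =>
    have h1 := ih fun b hb => hl b (List.mem_cons_of_mem _ hb)
    have h2 := hO.sideWeight_eq hM (hl d List.mem_cons_self)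
    rw [List.map_cons, List.sum_cons, List.length_cons, List.count_cons, h2]
    simp only [beq_iff_eq]
    push_cast
    linarith

theorem turnSum_leftmost_eq_zero (hO : M.IsThreeOrientation ξ O) {l : List M.graph.Dart}
    (hdir : ∀ d ∈ l, d ∈ O) (hl : l.IsChain (M.IsLeftmostTurn O)) :
    turnSum (outWeight ξ O) l = 0 :=
  turnSum_eq_zero (hl.imp_of_mem_imp fun a _ ha _ hab =>
    leftSum_outWeight_eq_zero hO (hdir a ha) hab)

/-- Neither weight nor flow leaves `A`, so the angle is constant around it; the identities for `P`
and `Q` therefore end at a common value. -/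
theorem potential_eq_of_fst_eq_vertexA (hM : M.IsTriangulation) (hO : M.IsThreeOrientation ξ O)
    {R : Reference M (M.vertexA ξ) (M.cornerFace ξ)} {f : M.graph.Dart → ℚ}
    (hf : R.IsPotential (outWeight ξ O) (sideWeight ξ) f) {a b : M.graph.Dart}
    (ha : a.fst = M.vertexA ξ) (hb : b.fst = M.vertexA ξ) : f a = f b := by
  obtain ⟨k, rfl⟩ := exists_pow_cw_eq (ha.trans hb.symm)
  clear hb
  induction k with
  | zero => rfl
  | succ k ih =>
    have hfst := (cw_pow_fst k a).trans ha
    have h1 := hO.sum_outWeight hM (M.vertexA ξ)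
    rw [if_pos rfl, Finset.sum_eq_zero_iff_of_nonneg fun d _ => outWeight_nonneg ξ O d] at h1
    have h2 := hf.cw ((M.cw ^ k) a)
    rw [h1 _ (Finset.mem_filter.2 ⟨Finset.mem_univ _, hfst⟩), hfst, R.flow_root,
      Pi.zero_apply] at h2
    rw [cw_pow_succ, ih]
    linarith

/-- The discrete Gauss-Bonnet comparison of a simple path with the leftmost path. -/
theorem length_add_turnSum_le (hM : M.IsTriangulation) (hO : M.IsThreeOrientation ξ O)
    {e : M.graph.Dart} (he : e ∈ O) {P Q : M.graph.Walk e.fst (M.vertexA ξ)}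
    (hP : IsLeftmostPath O e P) (hPp : P.IsPath) (hQ : Q.IsPath) {h : M.Face → ℚ}
    (hh : M.faceDiff h = net Q.darts - net P.darts) (hr : h (M.cornerFace ξ) = 0) :
    (P.length : ℚ) + 3 * h (M.leftFace (M.cw e)) + turnSum (outWeight ξ O) Q.darts ≤
      Q.length + 3 := by
  obtain ⟨R⟩ := nonempty_reference (M := M) (M.vertexA ξ) (M.cornerFace ξ)
  obtain ⟨f, hf⟩ := R.exists_isPotential (hO.sum_outWeight hM) (sum_sideWeight hM ξ)
    (hO.outWeight_add_symm hM)
  have hne : e.fst ≠ M.vertexA ξ := fun h => hO.notMem_of_fst_eq h he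
  obtain ⟨d, l, hd, hdfst⟩ := exists_darts_eq_cons Q hne
  have hP' := hP.darts_eq
  set l' := P.darts.tail
  have hid : ∀ (p : M.graph.Walk e.fst (M.vertexA ξ)), p.IsPath → ∀ d l, p.darts = d :: l →
      f d - f (M.faceNext ξ) = -(p.darts.map (sideWeight ξ)).sum -
        turnSum (outWeight ξ O) p.darts - 3 * R.wind p.darts (M.leftFace d) := by
    intro p hp d l hdl
    have h1 := R.potential_sub_eq hf d l (hdl ▸ isSimpleChain_darts hp)
    have h2 : ((d :: l).getLast (List.cons_ne_nil _ _)).snd = M.vertexA ξ := by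
      refine snd_of_mem_getLast? p _ ?_
      rw [hdl]
      exact List.getLast?_eq_some_getLast _
    have h3 : ∀ l : List M.graph.Dart, turnSum (0 : M.graph.Dart → ℚ) l = 0 := fun l =>
      turnSum_eq_zero (List.isChain_iff_getElem.2 fun _ _ => leftSum_zero _ _)
    rw [h2, R.flow_root, h3, potential_eq_of_fst_eq_vertexA hM hO hf
      ((faceNext_fst _).trans h2) (faceNext_fst ξ)] at h1
    rw [hdl]
    linarith
  have hidQ := hid Q hQ d l hd
  have hidP := hid P hPp e l' hP'
  rw [turnSum_leftmost_eq_zero hO hP.directed hP.leftmost] at hidP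
  have hwQ := R.faceDiff_wind Q
  have hwP := R.faceDiff_wind P
  rw [R.flow_root, add_zero] at hwQ hwP
  have hw : h = R.wind Q.darts - R.wind P.darts := by
    refine eq_of_faceDiff_eq (r := M.cornerFace ξ) ?_ ?_
    · rw [map_sub, hwQ, hwP, hh]
      ring_nf
    · rw [Pi.sub_apply, R.wind_root, R.wind_root, hr, sub_self]
  have hfst : e.fst = d.fst := hdfst.symm
  have hdQ : d ∈ Q.darts := by rw [hd]; exact List.mem_cons_self
  have heP : e ∈ P.darts := by rw [hP']; exact List.mem_cons_self
  have e1 := leftSum_telescope f hfst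
  have e2 : leftSum (fun b => f (M.cw b) - f b) e d =
      leftSum (outWeight ξ O - (3 : ℚ) • R.flow e.fst) e d := by
    refine leftSum_congr hfst fun b hb _ => ?_
    rw [hf.cw b, hb, hdfst]
    rfl
  rw [e2, leftSum_sub, leftSum_smul] at e1
  have e3 := hf.cw e
  have e4 := leftSum_leftFace hwQ hfst
  have e5 : leftSum (net Q.darts - R.flow e.fst) e d =
      leftSum ((-1 : ℚ) • R.flow e.fst) e d := by
    refine leftSum_congr hfst fun b hb hbd => ?_
    rw [Pi.sub_apply, net_eq_of_fst_eq hQ hdQ hdfst (hb.trans hdfst), if_neg hbd]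
    simp
  rw [e5, leftSum_smul] at e4
  have e6 := congrFun hwP e
  rw [faceDiff_apply, Pi.sub_apply, net_eq_of_fst_eq hPp heP rfl rfl, if_pos rfl,
    ← leftFace_cw] at e6
  have e7 := congrFun hw (M.leftFace (M.cw e))
  rw [Pi.sub_apply] at e7
  have e8 := leftSum_nonneg (outWeight_nonneg ξ O) e d
  have e9 := one_le_outWeight ξ he
  have s1 := neg_length_le_sum_sideWeight ξ Q.darts
  have s2 := hO.sum_sideWeight_le hM P.darts hP.directed
  have s3 : (P.darts.count ξ : ℚ) ≤ 1 := by
    exact_mod_cast List.nodup_iff_count_le_one.1 (isRegular_of_isPath hPp).nodup ξ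
  rw [SimpleGraph.Walk.length_darts] at s1 s2
  -- The constant 3 is `3 + 1 - 1`: crossing `e` at the start gives 3, a possible passage of `P`
  -- through `ξ` costs 1, and the weight of `e` itself gains 1.
  linarith

theorem neg_right_le_turnSum (hO : M.IsThreeOrientation ξ O)
    {e : M.graph.Dart} (he : e ∈ O) {P Q : M.graph.Walk e.fst (M.vertexA ξ)}
    (hP : IsLeftmostPath O e P) (hPp : P.IsPath) (hQ : Q.IsPath) {h : M.Face → ℚ}
    (hh : M.faceDiff h = net Q.darts - net P.darts) (hr : h (M.cornerFace ξ) = 0) :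
    -h (M.leftFace (M.cw e)) ≤ turnSum (outWeight ξ O) Q.darts := by
  have hne : e.fst ≠ M.vertexA ξ := fun h => hO.notMem_of_fst_eq h he
  obtain ⟨d, l, hd, hdfst⟩ := exists_darts_eq_cons Q hne
  have hP' := hP.darts_eq
  set l' := P.darts.tail
  have hlast : ∀ (p : M.graph.Walk e.fst (M.vertexA ξ)), ∀ d l, p.darts = d :: l →
      (d :: l).getLast (List.cons_ne_nil _ _) ∈ p.darts ∧
      ((d :: l).getLast (List.cons_ne_nil _ _)).snd = M.vertexA ξ := by
    intro p d l hdl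
    constructor
    · rw [hdl]; exact List.getLast_mem _
    · refine snd_of_mem_getLast? p _ ?_
      rw [hdl]
      exact List.getLast?_eq_some_getLast _
  obtain ⟨hq, hqA⟩ := hlast Q d l hd
  obtain ⟨hp, hpA⟩ := hlast P e l' hP'
  have h1 := right_last_nonneg hPp hQ hh hp hpA hq hqA (faceNext_fst ξ)
    (by rw [leftFace_faceNext]; exact hr)
  set H : M.graph.Dart → ℚ := fun p =>
    h (M.leftFace p.symm) - if p.symm ∈ Q.darts then 1 else 0 with hH
  have hchain : (e :: l').IsChain
      fun a b => H b - H a ≤ turnSumAt (outWeight ξ O) b.fst Q.darts := by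
    rw [← hP']
    refine hP.leftmost.imp_of_mem_imp fun a b ha hb hab => ?_
    exact right_sub_right_le hPp hQ hh (outWeight_nonneg ξ O) ha hb hab.fst_eq.symm
      (one_le_outWeight ξ hab.mem)
  have h2 := sub_le_sum_of_isChain (T := fun y => turnSumAt (outWeight ξ O) y Q.darts) e l' hchain
  -- `P` visits each vertex at most once, so no turn of `Q` is charged twice.
  have h3 : (l'.map fun b => turnSumAt (outWeight ξ O) b.fst Q.darts).sum ≤
      turnSum (outWeight ξ O) Q.darts := by
    have hnodup : (l'.map fun b => b.fst).Nodup := by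
      have := (isRegular_of_isPath hPp).1
      rw [hP', List.map_cons, List.nodup_cons] at this
      exact this.2
    rw [← sum_turnSumAt]
    have h4 := List.sum_toFinset (fun y => turnSumAt (outWeight ξ O) y Q.darts) hnodup
    rw [List.map_map] at h4
    refine h4.symm.le.trans ?_
    exact Finset.sum_le_sum_of_subset_of_nonneg (Finset.subset_univ _)
      fun y _ _ => turnSumAt_nonneg (outWeight_nonneg ξ O) y _
  -- `Q` stops at `A`, so it cannot run backwards along the last edge of `P`.
  have h5 : H ((e :: l').getLast (List.cons_ne_nil _ _)) =
      h (M.leftFace ((e :: l').getLast (List.cons_ne_nil _ _)).symm) := by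
    rw [hH]
    beta_reduce
    rw [if_neg fun hm => fst_ne_of_isPath hQ _ hm hpA, sub_zero]
  have h6 : H e ≤ h (M.leftFace (M.cw e)) := by
    rw [hH, leftFace_cw]
    beta_reduce
    split_ifs <;> linarith
  linarith

end PlanarMap

theorem mainTheorem6 {V : Type*} [Fintype V] [DecidableEq V] (M : PlanarMap V)
    (hM : M.IsTriangulation) (ξ : M.Corner) (O : Set M.graph.Dart)
    (hO : M.IsThreeOrientation ξ O) (hmin : M.IsMinimal ξ O)
    (e : M.graph.Dart) (he : e ∈ O) :
    (∃! P : M.graph.Walk e.fst (M.vertexA ξ), PlanarMap.IsLeftmostPath O e P) ∧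
    ∀ P : M.graph.Walk e.fst (M.vertexA ξ), PlanarMap.IsLeftmostPath O e P →
    ∀ Q : M.graph.Walk e.fst (M.vertexA ξ), Q.IsPath →
      (∃! h : M.Face → ℤ, PlanarMap.IsWinding (M.cornerFace ξ) (Q.append P.reverse) h) ∧
      ∀ h : M.Face → ℤ, PlanarMap.IsWinding (M.cornerFace ξ) (Q.append P.reverse) h →
        (Q.support.length : ℤ) ≥
          (P.support.length : ℤ) + 2 * (h (M.cornerFace (M.rightCorner e)) - 2) := by
  refine ⟨PlanarMap.existsUnique_isLeftmostPath hM hO hmin he, fun P hP Q hQ =>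
    ⟨PlanarMap.existsUnique_isWinding _ _, fun h hh => ?_⟩⟩
  have hPp := PlanarMap.isPath_of_isChain_isLeftmostTurn hM hO hmin P hP.directed hP.leftmost
  have hdiff := hh.faceDiff_eq
  rw [SimpleGraph.Walk.darts_append, PlanarMap.net_append, PlanarMap.net_reverse,
    ← sub_eq_add_neg] at hdiff
  have hr : ((h (M.cornerFace ξ) : ℤ) : ℚ) = 0 := by rw [hh.1, Int.cast_zero]
  have h1 := PlanarMap.length_add_turnSum_le hM hO he hP hPp hQ hdiff hr
  have h2 := PlanarMap.neg_right_le_turnSum hO he hP hPp hQ hdiff hr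
  have h3 := PlanarMap.turnSum_nonneg (PlanarMap.outWeight_nonneg ξ O) Q.darts
  rw [SimpleGraph.Walk.length_support, SimpleGraph.Walk.length_support]
  change _ ≥ _ + 2 * (h (M.leftFace (M.cw e)) - 2)
  -- For nonnegative winding, `3w - 3 ≥ 2w - 4`. For negative winding, `T ≥ -w` turns `3w + T` into
  -- at least `2w`.
  have key : (P.length : ℚ) + 2 * (h (M.leftFace (M.cw e)) - 2) ≤ Q.length := by
    rcases le_total 0 (h (M.leftFace (M.cw e)) : ℚ) with hw | hw <;> linarith
  have key' : (P.length : ℤ) + 2 * (h (M.leftFace (M.cw e)) - 2) ≤ Q.length := by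
    exact_mod_cast key
  push_cast
  linarith
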